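/- \textbf{Formulas.} Formulas of unit-free multiplicative linear logic $\mathsf{MLL}^-$ are built from atoms (propositional variables $a$ from a countable set, and their duals $a^\bot$) with the binary connectives $\otimes$ and ⅋. Linear negation is given by $a^{\bot\bot}=a$, $(A\otimes B)^\bot=B^\bot ⅋ A^\bot$, $(A ⅋ B)^\bot=B^\bot\otimes A^\bot$. \textbf{Pre-proof nets.} A \emph{pre-proof net} consists of a finite list of formulas $A_1,\dots,A_n$ (the conclusions), finitely many cuts (a cut is a tree $A\oplus A^\bot$ whose root is a special connective $\oplus$, allowed only there), seen as a forest of formula trees, and a perfect matching of the set of all leaves (atom occurrences) of this forest that matches only dual atoms. As a graph, its vertices are all subformula occurrences and all cuts, and its edges are the edges of the forest and the edges of the matching. A \emph{switching} is a graph obtained by removing, for every ⅋-node, one of the two edges to its children. A pre-proof net is \emph{correct} if all its switchings are connected and acyclic (the Danos--Regnier criterion); the empty graph does not count as connected. \textbf{Sequent calculus.} Sequents are finite lists of formulas. The rules are: $\mathsf{id}$: $\vdash A^\bot,A$; $\mathsf{exch}$: from $\vdash\Gamma,A,B,\Delta$ infer $\vdash\Gamma,B,A,\Delta$; ⅋: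 from $\vdash\Gamma,A,B,\Delta$ infer $\vdash\Gamma,A ⅋ B,\Delta$; $\otimes$: from $\vdash\Gamma,A$ and $\vdash B,\Delta$ infer $\vdash\Gamma,A\otimes B,\Delta$; $\mathsf{cut}$: from $\vdash\Gamma,A$ and $\vdash A^\bot,\Delta$ infer $\vdash\Gamma,\Delta$. \textbf{Calculus of structures.} A proof starts from nothing with an instance of $\mathsf{i}\!\downarrow$, giving $A^\bot ⅋ A$, and proceeds by the following rewritings (premise $\to$ conclusion) inside an arbitrary formula context: $B\to(A^\bot ⅋ A)\otimes B$ ($\mathsf{i}\!\downarrow$); $B ⅋ (A\otimes A^\bot)\to B$ ($\mathsf{i}\!\uparrow$); $A ⅋ B\to B ⅋ A$; $A\otimes B\to B\otimes A$; $A ⅋ (B ⅋ C)\to(A ⅋ B) ⅋ C$; $A\otimes(B\otimes C)\to(A\otimes B)\otimes C$; $A\otimes(B ⅋ C)\to(A\otimes B) ⅋ C$ (switch). A further form of $\mathsf{i}\!\uparrow$ may end the proof by leading from $A\otimes A^\bot$ to the empty conclusion. \textbf{Translation.} A proof is translated into a pre-proof net by tracing the atom occurrences through it. Each instance of $\mathsf{id}$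 or $\mathsf{i}\!\downarrow$ matches every atom occurrence of $A$ with the corresponding dual occurrence of $A^\bot$; each instance of $\mathsf{cut}$ or $\mathsf{i}\!\uparrow$ contributes a cut $A\oplus A^\bot$, and tracing does not continue through it. A proof in the calculus of structures translates into a net with conclusions $A_1,\dots,A_n$ if its conclusion is $A_1 ⅋\cdots ⅋ A_n$ (the empty conclusion if $n=0$). The order of the cuts is immaterial. A pre-proof net is \emph{sequentializable} if it is the translation of some proof in the sequent calculus or in the calculus of structures. \textbf{Theorem.} A pre-proof net $\pi$ of $\mathsf{MLL}^-$ is correct if and only if it is sequentializable. Moreover, each system suffices on its own: $\pi$ is correct if and only if it is the translation of a sequent calculus proof, and if and only if it is the translation of a proof in the calculus of structures. -/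

import Mathlib

namespace MLL

/-! ### Formulas and sequent forests -/

/-- Binary trees with inner nodes `⊗` and `⅋` and leaves taken from `α`. With `α = Atom` these are
the formulas. With `α` a set of leaf occurrences they are formula trees all of whose leaves carry a
name. -/
inductive FTree (α : Type*) where
  | leaf : α → FTree α
  | tens : FTree α → FTree α → FTree α
  | par : FTree α → FTree α → FTree α

namespace FTree

variable {α β : Type*}

/-- Relabelling of the leaves. -/
def map (f : α → β) : FTree α → FTree β
  | leaf a => leaf (f a)
  | tens A B => tens (map f A) (map f B)
  | par A B => par (map f A) (map f B)

/-- De Morgan dual with reversed order of the arguments; a leaf `a` becomes `f a`. -/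
def dual (f : α → α) : FTree α → FTree α
  | leaf a => leaf (f a)
  | tens A B => par (dual f B) (dual f A)
  | par A B => tens (dual f B) (dual f A)

/-- The list of leaves from left to right. -/
def leaves : FTree α → List α
  | leaf a => [a]
  | tens A B => leaves A ++ leaves B
  | par A B => leaves A ++ leaves B

/-- `IsSub A F`: the tree `A` is a (not necessarily proper) subtree of `F`. -/
def IsSub (A : FTree α) : FTree α → Prop
  | leaf a => A = leaf a
  | tens F G => A = tens F G ∨ IsSub A F ∨ IsSub A G
  | par F G => A = par F G ∨ IsSub A F ∨ IsSub A G

/-- `A₁ ⅋ (A₂ ⅋ (⋯ ⅋ Aₙ))`; for `n = 0` there is no formula, which is `none`. -/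
def bigPar : List (FTree α) → Option (FTree α)
  | [] => none
  | A :: Γ =>
    match bigPar Γ with
    | none => some A
    | some B => some (par A B)

end FTree

/-- Propositional variables (indexed by `ℕ`) and their duals. -/
inductive Atom where
  | pos : ℕ → Atom
  | neg : ℕ → Atom

/-- Linear negation of atoms. -/
def Atom.dual : Atom → Atom
  | .pos n => .neg n
  | .neg n => .pos n

/-- Formulas of unit-free multiplicative linear logic. -/
abbrev Formula := FTree Atom

/-- Linear negation: `(A ⊗ B)^⊥ = B^⊥ ⅋ A^⊥` and `(A ⅋ B)^⊥ = B^⊥ ⊗ A^⊥`. -/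
def Formula.neg (A : Formula) : Formula := FTree.dual Atom.dual A

/-! ### Pre-proof nets and the switching criterion -/

/-- A pre-proof net with set of leaf occurrences `V`: a sequent forest `concl`, a list of cuts
(the pair `(A, B)` is the formula tree whose root is the cut connective and whose two immediate
subtrees `A`, `B` are dual to each other), every element of `V` being exactly one leaf of the whole
forest, together with a perfect matching `link` of the leaves which only matches dual atoms. -/
structure PreProofNet (V : Type*) where
  /-- the atom which is written at a leaf -/
  lab : V → Atom
  /-- the formula trees of the conclusions -/
  concl : List (FTree V)
  /-- the cuts -/
  cuts : List (FTree V × FTree V)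
  cut_dual : ∀ c ∈ cuts, c.2.map lab = Formula.neg (c.1.map lab)
  /-- no leaf occurs twice -/
  nodup : (concl.flatMap FTree.leaves ++
    cuts.flatMap fun c => c.1.leaves ++ c.2.leaves).Nodup
  /-- every element of `V` is a leaf of the forest -/
  exhaust : ∀ v, v ∈ concl.flatMap FTree.leaves ++
    cuts.flatMap fun c => c.1.leaves ++ c.2.leaves
  /-- the partner of a leaf in the perfect matching -/
  link : V → V
  link_link : ∀ v, link (link v) = v
  link_dual : ∀ v, lab (link v) = (lab v).dual

/-- Candidates for nodes of a net: subformula occurrences and cuts. Since no leaf occurs twice in a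
net, distinct occurrences of subformulas in a net are distinct as trees over `V`, so that an
occurrence can be identified with the subtree which is rooted there. -/
inductive Node (V : Type*) where
  | sub : FTree V → Node V
  | cut : FTree V → FTree V → Node V

namespace PreProofNet

variable {V : Type*} (π : PreProofNet V)

/-- The nodes of `π`: all subformula occurrences of its conclusions and of both sides of its cuts,
and one node for each cut. -/
def IsNode : Node V → Prop
  | .sub A => (∃ F ∈ π.concl, A.IsSub F) ∨ ∃ c ∈ π.cuts, A.IsSub c.1 ∨ A.IsSub c.2
  | .cut A B => (A, B) ∈ π.cuts

/-- The edges which remain under the switching `s`: identity links, both edges of a `⊗`-node and of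
a cut node to its children, and the edge of a `⅋`-node `A ⅋ B` to `A` if `s (A ⅋ B)` is true and to
`B` otherwise. -/
inductive Edge (s : FTree V → Bool) : Node V → Node V → Prop
  | link (v : V) : Edge s (.sub (.leaf v)) (.sub (.leaf (π.link v)))
  | tensLeft (A B : FTree V) : Edge s (.sub (.tens A B)) (.sub A)
  | tensRight (A B : FTree V) : Edge s (.sub (.tens A B)) (.sub B)
  | cutLeft (A B : FTree V) : Edge s (.cut A B) (.sub A)
  | cutRight (A B : FTree V) : Edge s (.cut A B) (.sub B)
  | parLeft (A B : FTree V) : s (.par A B) = true → Edge s (.sub (.par A B)) (.sub A)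
  | parRight (A B : FTree V) : s (.par A B) = false → Edge s (.sub (.par A B)) (.sub B)

/-- The switching of `π` in which `s` tells for every `⅋`-node which edge to a child is kept. -/
def switching (s : FTree V → Bool) : SimpleGraph {n : Node V // π.IsNode n} :=
  SimpleGraph.fromRel fun m n => π.Edge s m n

/-- The switching criterion: all switchings are connected and acyclic. -/
def Correct : Prop :=
  ∀ s : FTree V → Bool, (π.switching s).Connected ∧ (π.switching s).IsAcyclic

end PreProofNet

/-! ### Sequent calculus -/

/-- Sequent calculus proofs of a sequent, which is a list of formulas. -/
inductive SCProof : List Formula → Type where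
  | id (A : Formula) : SCProof [A.neg, A]
  | exch (Γ Δ : List Formula) (A B : Formula) :
      SCProof (Γ ++ A :: B :: Δ) → SCProof (Γ ++ B :: A :: Δ)
  | par (Γ Δ : List Formula) (A B : Formula) :
      SCProof (Γ ++ A :: B :: Δ) → SCProof (Γ ++ FTree.par A B :: Δ)
  | tens (Γ Δ : List Formula) (A B : Formula) :
      SCProof (Γ ++ [A]) → SCProof (B :: Δ) → SCProof (Γ ++ FTree.tens A B :: Δ)
  | cut (Γ Δ : List Formula) (A : Formula) :
      SCProof (Γ ++ [A]) → SCProof (A.neg :: Δ) → SCProof (Γ ++ Δ)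

/-- Tracing of the atom occurrences through a sequent calculus proof (its flow graph, which does not
flow through cuts). `P.Traces lab link G K` says that the atom occurrences in the proof `P` can be
named by elements of `V` such that

* the name `v` is only given to occurrences of the atom `lab v`;
* an atom occurrence in a premise of a rule has the same name as the corresponding occurrence in
  the conclusion;
* the occurrences of an atom in `A` and of its dual in `A^⊥` which correspond to each other in an
  instance of `id` carry names which are exchanged by `link`;
* the end sequent becomes the list of named formulas `G`, and the list of the cut formulas
  (the pair of `A` and `A^⊥` for each instance of `cut`) becomes `K`. -/
def SCProof.Traces {V : Type*} (lab : V → Atom) (link : V → V) :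
    {Γ : List Formula} → SCProof Γ → List (FTree V) → List (FTree V × FTree V) → Prop
  | _, .id A, G, K =>
      ∃ X : FTree V, X.map lab = A ∧ G = [X.dual link, X] ∧ K = []
  | _, .exch Γ Δ A B P, G, K =>
      ∃ (G₁ G₂ : List (FTree V)) (X Y : FTree V),
        G₁.map (FTree.map lab) = Γ ∧ G₂.map (FTree.map lab) = Δ ∧ X.map lab = A ∧ Y.map lab = B ∧
        G = G₁ ++ Y :: X :: G₂ ∧ P.Traces lab link (G₁ ++ X :: Y :: G₂) K
  | _, .par Γ Δ A B P, G, K =>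
      ∃ (G₁ G₂ : List (FTree V)) (X Y : FTree V),
        G₁.map (FTree.map lab) = Γ ∧ G₂.map (FTree.map lab) = Δ ∧ X.map lab = A ∧ Y.map lab = B ∧
        G = G₁ ++ FTree.par X Y :: G₂ ∧ P.Traces lab link (G₁ ++ X :: Y :: G₂) K
  | _, .tens Γ Δ A B P Q, G, K =>
      ∃ (G₁ G₂ : List (FTree V)) (X Y : FTree V) (K₁ K₂ : List (FTree V × FTree V)),
        G₁.map (FTree.map lab) = Γ ∧ G₂.map (FTree.map lab) = Δ ∧ X.map lab = A ∧ Y.map lab = B ∧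
        G = G₁ ++ FTree.tens X Y :: G₂ ∧ K = K₁ ++ K₂ ∧
        P.Traces lab link (G₁ ++ [X]) K₁ ∧ Q.Traces lab link (Y :: G₂) K₂
  | _, .cut Γ Δ A P Q, G, K =>
      ∃ (G₁ G₂ : List (FTree V)) (X Y : FTree V) (K₁ K₂ : List (FTree V × FTree V)),
        G₁.map (FTree.map lab) = Γ ∧ G₂.map (FTree.map lab) = Δ ∧
        X.map lab = A ∧ Y.map lab = A.neg ∧
        G = G₁ ++ G₂ ∧ K = (X, Y) :: (K₁ ++ K₂) ∧
        P.Traces lab link (G₁ ++ [X]) K₁ ∧ Q.Traces lab link (Y :: G₂) K₂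

/-! ### Calculus of structures -/

/-- Formula contexts with exactly one hole. -/
inductive Ctx (α : Type*) where
  | hole : Ctx α
  | tensLeft : Ctx α → FTree α → Ctx α
  | tensRight : FTree α → Ctx α → Ctx α
  | parLeft : Ctx α → FTree α → Ctx α
  | parRight : FTree α → Ctx α → Ctx α

namespace Ctx

variable {α β : Type*}

/-- Plugging a tree into the hole. -/
def fill : Ctx α → FTree α → FTree α
  | hole, A => A
  | tensLeft S B, A => .tens (fill S A) B
  | tensRight B S, A => .tens B (fill S A)
  | parLeft S B, A => .par (fill S A) B
  | parRight B S, A => .par B (fill S A)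

/-- Relabelling of the leaves. -/
def map (f : α → β) : Ctx α → Ctx β
  | hole => hole
  | tensLeft S B => tensLeft (map f S) (B.map f)
  | tensRight B S => tensRight (B.map f) (map f S)
  | parLeft S B => parLeft (map f S) (B.map f)
  | parRight B S => parRight (B.map f) (map f S)

end Ctx

/-- `DeepRule A B`: the rules of the calculus of structures which rewrite `S{A}` to `S{B}` in an
arbitrary context `S{ }` (premise first, conclusion second). -/
inductive DeepRule : Formula → Formula → Type where
  | iDown (A B : Formula) : DeepRule B (.tens (.par A.neg A) B)
  | iUp (A B : Formula) : DeepRule (.par B (.tens A A.neg)) B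
  | comDown (A B : Formula) : DeepRule (.par A B) (.par B A)
  | comUp (A B : Formula) : DeepRule (.tens A B) (.tens B A)
  | assDown (A B C : Formula) : DeepRule (.par A (.par B C)) (.par (.par A B) C)
  | assUp (A B C : Formula) : DeepRule (.tens A (.tens B C)) (.tens (.tens A B) C)
  | switch (A B C : Formula) : DeepRule (.tens A (.par B C)) (.par (.tens A B) C)

/-- Proofs in the calculus of structures: derivations which start from nothing with the premise-free
rule `i↓`. The conclusion is a formula or, after the conclusion-free rule `i↑`, nothing (`none`). -/
inductive CoSProof : Option Formula → Type where
  | start (A : Formula) : CoSProof (some (.par A.neg A))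
  | step (S : Ctx Atom) {A B : Formula} (r : DeepRule A B) :
      CoSProof (some (S.fill A)) → CoSProof (some (S.fill B))
  | refute (A : Formula) : CoSProof (some (.tens A A.neg)) → CoSProof none

/-- Tracing of the atom occurrences through a rule instance: the premise is named as `T`, the
conclusion as `U`, and `K` is the list of the cuts which are introduced (one for `i↑`, otherwise
none). -/
def DeepRule.Traces {V : Type*} (lab : V → Atom) (link : V → V) :
    {A B : Formula} → DeepRule A B → FTree V → FTree V → List (FTree V × FTree V) → Prop
  | _, _, .iDown A B, T, U, K =>
      ∃ X Y : FTree V, X.map lab = A ∧ Y.map lab = B ∧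
        T = Y ∧ U = .tens (.par (X.dual link) X) Y ∧ K = []
  | _, _, .iUp A B, T, U, K =>
      ∃ X X' Y : FTree V, X.map lab = A ∧ X'.map lab = A.neg ∧ Y.map lab = B ∧
        T = .par Y (.tens X X') ∧ U = Y ∧ K = [(X, X')]
  | _, _, .comDown A B, T, U, K =>
      ∃ X Y : FTree V, X.map lab = A ∧ Y.map lab = B ∧
        T = .par X Y ∧ U = .par Y X ∧ K = []
  | _, _, .comUp A B, T, U, K =>
      ∃ X Y : FTree V, X.map lab = A ∧ Y.map lab = B ∧
        T = .tens X Y ∧ U = .tens Y X ∧ K = []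
  | _, _, .assDown A B C, T, U, K =>
      ∃ X Y Z : FTree V, X.map lab = A ∧ Y.map lab = B ∧ Z.map lab = C ∧
        T = .par X (.par Y Z) ∧ U = .par (.par X Y) Z ∧ K = []
  | _, _, .assUp A B C, T, U, K =>
      ∃ X Y Z : FTree V, X.map lab = A ∧ Y.map lab = B ∧ Z.map lab = C ∧
        T = .tens X (.tens Y Z) ∧ U = .tens (.tens X Y) Z ∧ K = []
  | _, _, .switch A B C, T, U, K =>
      ∃ X Y Z : FTree V, X.map lab = A ∧ Y.map lab = B ∧ Z.map lab = C ∧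
        T = .tens X (.par Y Z) ∧ U = .par (.tens X Y) Z ∧ K = []

/-- Tracing of the atom occurrences through a proof in the calculus of structures, with the same
meaning as for the sequent calculus: the conclusion is named as `G`, and `K` lists the named cut
formulas of the instances of `i↑`. -/
def CoSProof.Traces {V : Type*} (lab : V → Atom) (link : V → V) :
    {F : Option Formula} → CoSProof F → Option (FTree V) → List (FTree V × FTree V) → Prop
  | _, .start A, G, K =>
      ∃ X : FTree V, X.map lab = A ∧ G = some (.par (X.dual link) X) ∧ K = []
  | _, .step S r P, G, K =>
      ∃ (S' : Ctx V) (T U : FTree V) (K₁ K₂ : List (FTree V × FTree V)),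
        S'.map lab = S ∧ r.Traces lab link T U K₁ ∧
        G = some (S'.fill U) ∧ K = K₁ ++ K₂ ∧ P.Traces lab link (some (S'.fill T)) K₂
  | _, .refute A P, G, K =>
      ∃ (X X' : FTree V) (K' : List (FTree V × FTree V)), X.map lab = A ∧ X'.map lab = A.neg ∧
        G = none ∧ K = (X, X') :: K' ∧ P.Traces lab link (some (.tens X X')) K'

/-! ### Sequentialization -/

namespace PreProofNet

variable {V : Type*} (π : PreProofNet V)

/-- The sequent calculus proof `P` translates into `π`; the order of the cuts is immaterial. -/
def IsTranslationSC {Γ : List Formula} (P : SCProof Γ) : Prop :=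
  ∃ K, P.Traces π.lab π.link π.concl K ∧ K.Perm π.cuts

/-- The proof `P` in the calculus of structures translates into `π`: if `A₁, …, Aₙ` are the
conclusions of `π` then `P` is a proof of `A₁ ⅋ ⋯ ⅋ Aₙ`; the order of the cuts is immaterial. -/
def IsTranslationCoS {F : Option Formula} (P : CoSProof F) : Prop :=
  ∃ K, P.Traces π.lab π.link (FTree.bigPar π.concl) K ∧ K.Perm π.cuts

/-- `π` is the translation of a sequent calculus proof. -/
def SequentializableSC : Prop :=
  ∃ (Γ : List Formula) (P : SCProof Γ), π.IsTranslationSC P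

/-- `π` is the translation of a proof in the calculus of structures. -/
def SequentializableCoS : Prop :=
  ∃ (F : Option Formula) (P : CoSProof F), π.IsTranslationCoS P

/-- `π` is the translation of a proof in the sequent calculus or in the calculus of structures. -/
def Sequentializable : Prop :=
  π.SequentializableSC ∨ π.SequentializableCoS

end PreProofNet

end MLL

/-! All notions are compared with one auxiliary system, `Seq`. Its sequents and cuts are multisets
of formulas whose leaves carry names, and its axioms are atomic. The names do the tracing: the net
of a derivation is read off its conclusion, its cuts and `link`.

Proof side. Sequent proofs differ from `Seq` only by exchanges and by axioms for compound formulas,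
which expand to atomic ones. For the calculus of structures, the ⅋-rule of `Seq` is invertible
(`Seq.par_inv`) and a ⊗ can be traced up to the rule that introduces it (`Seq.tens_elim`), so each
deep rule is admissible in every context. Conversely a sequent is read as a ⅋; two proofs are placed
side by side with the help of `i↓`, and two switches bring the side formulas out of the resulting ⊗.

Net side. A cut is treated as a ⊗. In a switching, contract the links, the kept edges of the ⅋-nodes
and the left edges of the ⊗-nodes. There remains a graph whose vertices are blocks (pairs of linked
leaves) and which has one edge per ⊗. All switchings have the same numbers of vertices and edges, so
correctness means that every contracted graph is connected and that twice the number of ⊗-nodes plus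
two is the number of leaves (`PreProofNet.correct_iff`). Both conditions are preserved by the rules
of `Seq`.

Sequentialization avoids splitting tensors and works from the axioms downwards (`Seq.of_connM`). The
leaves of the forest are formulas already built, grouped into blocks which are provable sequents,
with one block more than there are ⊗-nodes. A ⊗ of two leaves merges their blocks by the ⊗-rule; a ⅋
of two leaves in one block is an instance of the ⅋-rule. If neither exists, each ⊗ has at most one
leaf as a child, so some block touches no ⊗ and can be isolated by a suitable switching. By
connectedness it is the only block, and the forest is exactly this provable sequent
(`eq_leaves_of_noRedex`). -/

namespace MLL

open FTree

/-! ### The auxiliary sequent system and the admissibility of the deep rules in it. -/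

section Seq

variable {V : Type*}

/-- Cut pairs of named formulas. -/
abbrev Cuts (V : Type*) := Multiset (FTree V × FTree V)

/-- Provability of named sequents, up to the order of formulas and cuts, with atomic axioms. -/
inductive Seq (lab : V → Atom) (link : V → V) : Multiset (FTree V) → Cuts V → Prop
  | ax (v : V) : Seq lab link {leaf (link v), leaf v} 0
  | par {X Y : FTree V} {G : Multiset (FTree V)} {K : Cuts V} :
      Seq lab link (X ::ₘ Y ::ₘ G) K → Seq lab link (par X Y ::ₘ G) K
  | tens {X Y : FTree V} {G₁ G₂ : Multiset (FTree V)} {K₁ K₂ : Cuts V} :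
      Seq lab link (X ::ₘ G₁) K₁ → Seq lab link (Y ::ₘ G₂) K₂ →
      Seq lab link (tens X Y ::ₘ (G₁ + G₂)) (K₁ + K₂)
  | cut {X Y : FTree V} {G₁ G₂ : Multiset (FTree V)} {K₁ K₂ : Cuts V} :
      Y.map lab = Formula.neg (X.map lab) →
      Seq lab link (X ::ₘ G₁) K₁ → Seq lab link (Y ::ₘ G₂) K₂ →
      Seq lab link (G₁ + G₂) ((X, Y) ::ₘ (K₁ + K₂))

namespace Seq

variable {lab : V → Atom} {link : V → V}

theorem congr {G G' : Multiset (FTree V)} {K K' : Cuts V} (h : Seq lab link G K)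
    (hG : G' = G) (hK : K' = K) : Seq lab link G' K' := by
  subst hG hK; exact h

/-- Axioms for arbitrary formulas. -/
theorem identity (X : FTree V) : Seq lab link {X.dual link, X} 0 := by
  induction X with
  | leaf v => exact ax v
  | tens A B hA hB =>
    have hA' : Seq lab link (A ::ₘ {A.dual link}) 0 := hA.congr (Multiset.pair_comm _ _) rfl
    have hB' : Seq lab link (B ::ₘ {B.dual link}) 0 := hB.congr (Multiset.pair_comm _ _) rfl
    refine (par (X := B.dual link) (Y := A.dual link) (G := {A.tens B})
      ((hA'.tens hB').congr ?_ (by simp))).congr rfl rfl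
    simp only [← Multiset.singleton_add]; abel
  | par A B hA hB =>
    refine (par (X := A) (Y := B) (G := {(A.par B).dual link})
      ((hB.tens hA).congr (K' := 0) ?_ (by simp))).congr (Multiset.pair_comm _ _) rfl
    simp only [← Multiset.singleton_add, dual]; abel

/-- A `⊗`-formula in a provable sequent may be replaced by anything which can be obtained from its
two immediate subformulas. -/
theorem tens_elim {X Y : FTree V} {W : Multiset (FTree V)} {K₀ : Cuts V}
    (h : ∀ G₁ G₂ K₁ K₂, Seq lab link (X ::ₘ G₁) K₁ → Seq lab link (Y ::ₘ G₂) K₂ →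
      Seq lab link (W + (G₁ + G₂)) (K₀ + (K₁ + K₂)))
    {G : Multiset (FTree V)} {K : Cuts V} (hG : Seq lab link (FTree.tens X Y ::ₘ G) K) :
    Seq lab link (W + G) (K₀ + K) := by
  generalize hM : FTree.tens X Y ::ₘ G = M at hG
  induction hG generalizing G with
  -- Axioms are atomic, so no compound formula occurs in one.
  | ax v =>
    have : FTree.tens X Y ∈ ({leaf (link v), leaf v} : Multiset (FTree V)) := by simp [← hM]
    simp at this
  | @par A B G' K _ ih =>
    rw [Multiset.cons_eq_cons] at hM
    obtain ⟨h, -⟩ | ⟨-, cs, rfl, rfl⟩ := hM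
    · cases h
    · refine (par (X := A) (Y := B) (G := W + cs) ((ih (G := A ::ₘ B ::ₘ cs) ?_).congr ?_ rfl)).congr
        ?_ rfl
      all_goals try simp only [← Multiset.singleton_add]
      all_goals abel
  | @tens A B G₁ G₂ K₁ K₂ h₁ h₂ ih₁ ih₂ =>
    rw [Multiset.cons_eq_cons] at hM
    -- Either this rule introduces the formula in question, and `h` applies to its premises, or the
    -- formula is a side formula of exactly one premise, where the induction hypothesis applies.
    obtain ⟨h', rfl⟩ | ⟨-, cs, rfl, hcs⟩ := hM
    · cases h'
      exact h _ _ _ _ h₁ h₂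
    · have hm : FTree.tens X Y ∈ G₁ + G₂ := by simp [hcs]
      obtain hm | hm := Multiset.mem_add.1 hm
      · obtain ⟨G₁', rfl⟩ := Multiset.exists_cons_of_mem hm
        rw [Multiset.cons_add, Multiset.cons_inj_right] at hcs
        subst hcs
        refine (tens (X := A) (Y := B) (G₁ := W + G₁') ((ih₁ (G := A ::ₘ G₁') ?_).congr ?_ rfl)
          h₂).congr ?_ ?_
        all_goals try simp only [← Multiset.singleton_add]
        all_goals abel
      · obtain ⟨G₂', rfl⟩ := Multiset.exists_cons_of_mem hm
        rw [Multiset.add_cons, Multiset.cons_inj_right] at hcs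
        subst hcs
        refine (tens (X := A) (Y := B) (G₂ := W + G₂') h₁
          ((ih₂ (G := B ::ₘ G₂') ?_).congr ?_ rfl)).congr ?_ ?_
        all_goals try simp only [← Multiset.singleton_add]
        all_goals abel
  | @cut A B G₁ G₂ K₁ K₂ hd h₁ h₂ ih₁ ih₂ =>
    have hm : FTree.tens X Y ∈ G₁ + G₂ := by simp [← hM]
    obtain hm | hm := Multiset.mem_add.1 hm
    · obtain ⟨G₁', rfl⟩ := Multiset.exists_cons_of_mem hm
      rw [Multiset.cons_add, Multiset.cons_inj_right] at hM
      subst hM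
      refine (cut (X := A) (Y := B) (G₁ := W + G₁') hd ((ih₁ (G := A ::ₘ G₁') ?_).congr ?_ rfl)
        h₂).congr ?_ ?_
      all_goals try simp only [← Multiset.singleton_add]
      all_goals abel
    · obtain ⟨G₂', rfl⟩ := Multiset.exists_cons_of_mem hm
      rw [Multiset.add_cons, Multiset.cons_inj_right] at hM
      subst hM
      refine (cut (X := A) (Y := B) (G₂ := W + G₂') hd h₁
        ((ih₂ (G := B ::ₘ G₂') ?_).congr ?_ rfl)).congr ?_ ?_
      all_goals try simp only [← Multiset.singleton_add]
      all_goals abel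

/-- The `⅋`-rule is invertible. -/
theorem par_inv {X Y : FTree V} {G : Multiset (FTree V)} {K : Cuts V}
    (hG : Seq lab link (FTree.par X Y ::ₘ G) K) : Seq lab link (X ::ₘ Y ::ₘ G) K := by
  generalize hM : FTree.par X Y ::ₘ G = M at hG
  induction hG generalizing G with
  | ax v =>
    have : FTree.par X Y ∈ ({leaf (link v), leaf v} : Multiset (FTree V)) := by simp [← hM]
    simp at this
  | @par A B G' K h ih =>
    rw [Multiset.cons_eq_cons] at hM
    obtain ⟨h', rfl⟩ | ⟨-, cs, rfl, rfl⟩ := hM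
    · cases h'
      exact h
    · refine (par (X := A) (Y := B) (G := X ::ₘ Y ::ₘ cs)
        ((ih (G := A ::ₘ B ::ₘ cs) ?_).congr ?_ rfl)).congr ?_ rfl
      all_goals try simp only [← Multiset.singleton_add]
      all_goals abel
  | @tens A B G₁ G₂ K₁ K₂ h₁ h₂ ih₁ ih₂ =>
    rw [Multiset.cons_eq_cons] at hM
    obtain ⟨h', -⟩ | ⟨-, cs, rfl, hcs⟩ := hM
    · cases h'
    · have hm : FTree.par X Y ∈ G₁ + G₂ := by simp [hcs]
      obtain hm | hm := Multiset.mem_add.1 hm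
      · obtain ⟨G₁', rfl⟩ := Multiset.exists_cons_of_mem hm
        rw [Multiset.cons_add, Multiset.cons_inj_right] at hcs
        subst hcs
        refine (tens (X := A) (Y := B) (G₁ := X ::ₘ Y ::ₘ G₁')
          ((ih₁ (G := A ::ₘ G₁') ?_).congr ?_ rfl) h₂).congr ?_ ?_
        all_goals try simp only [← Multiset.singleton_add]
        all_goals abel
      · obtain ⟨G₂', rfl⟩ := Multiset.exists_cons_of_mem hm
        rw [Multiset.add_cons, Multiset.cons_inj_right] at hcs
        subst hcs
        refine (tens (X := A) (Y := B) (G₂ := X ::ₘ Y ::ₘ G₂') h₁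
          ((ih₂ (G := B ::ₘ G₂') ?_).congr ?_ rfl)).congr ?_ ?_
        all_goals try simp only [← Multiset.singleton_add]
        all_goals abel
  | @cut A B G₁ G₂ K₁ K₂ hd h₁ h₂ ih₁ ih₂ =>
    have hm : FTree.par X Y ∈ G₁ + G₂ := by simp [← hM]
    obtain hm | hm := Multiset.mem_add.1 hm
    · obtain ⟨G₁', rfl⟩ := Multiset.exists_cons_of_mem hm
      rw [Multiset.cons_add, Multiset.cons_inj_right] at hM
      subst hM
      refine (cut (X := A) (Y := B) (G₁ := X ::ₘ Y ::ₘ G₁') hd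
        ((ih₁ (G := A ::ₘ G₁') ?_).congr ?_ rfl) h₂).congr ?_ ?_
      all_goals try simp only [← Multiset.singleton_add]
      all_goals abel
    · obtain ⟨G₂', rfl⟩ := Multiset.exists_cons_of_mem hm
      rw [Multiset.add_cons, Multiset.cons_inj_right] at hM
      subst hM
      refine (cut (X := A) (Y := B) (G₂ := X ::ₘ Y ::ₘ G₂') hd h₁
        ((ih₂ (G := B ::ₘ G₂') ?_).congr ?_ rfl)).congr ?_ ?_
      all_goals try simp only [← Multiset.singleton_add]
      all_goals abel

/-- A conclusion `X ⊗ X^⊥` may be turned into a cut. -/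
theorem tens_to_cut {X Y : FTree V} (hd : Y.map lab = Formula.neg (X.map lab))
    {G : Multiset (FTree V)} {K : Cuts V} (h : Seq lab link (FTree.tens X Y ::ₘ G) K) :
    Seq lab link G ((X, Y) ::ₘ K) :=
  (tens_elim (W := 0) (K₀ := {(X, Y)})
    (fun _ _ _ _ h₁ h₂ => (cut hd h₁ h₂).congr (by simp) (by simp)) h).congr (by simp) (by simp)

end Seq

/-- `Adm lab link T U K`: in provable sequents `T` may be replaced by `U`, adding the cuts `K`. -/
def Adm (lab : V → Atom) (link : V → V) (T U : FTree V) (K₀ : Cuts V) : Prop :=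
  ∀ G K, Seq lab link (T ::ₘ G) K → Seq lab link (U ::ₘ G) (K₀ + K)

namespace Adm

variable {lab : V → Atom} {link : V → V}

theorem tensLeft {T U : FTree V} {K₀ : Cuts V} (h : Adm lab link T U K₀) (B : FTree V) :
    Adm lab link (.tens T B) (.tens U B) K₀ := fun _ _ hG =>
  Seq.tens_elim (W := {.tens U B}) (fun _ _ _ _ h₁ h₂ =>
    ((h _ _ h₁).tens h₂).congr (by simp) (by rw [add_assoc])) hG

theorem tensRight {T U : FTree V} {K₀ : Cuts V} (h : Adm lab link T U K₀) (B : FTree V) :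
    Adm lab link (.tens B T) (.tens B U) K₀ := fun _ _ hG =>
  Seq.tens_elim (W := {.tens B U}) (fun _ _ _ _ h₁ h₂ =>
    (h₁.tens (h _ _ h₂)).congr (by simp) (by abel)) hG

theorem parLeft {T U : FTree V} {K₀ : Cuts V} (h : Adm lab link T U K₀) (B : FTree V) :
    Adm lab link (.par T B) (.par U B) K₀ := fun _ _ hG => (h _ _ hG.par_inv).par

theorem parRight {T U : FTree V} {K₀ : Cuts V} (h : Adm lab link T U K₀) (B : FTree V) :
    Adm lab link (.par B T) (.par B U) K₀ := fun _ _ hG =>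
  ((h _ _ (hG.par_inv.congr (Multiset.cons_swap _ _ _) rfl)).congr
    (Multiset.cons_swap _ _ _) rfl).par

/-- A ⊗ above the hole is traced to the rule that introduces it, a ⅋ is inverted; the rewriting
takes place in a premise, and the same rule restores the connective. -/
theorem fill {T U : FTree V} {K₀ : Cuts V} (h : Adm lab link T U K₀) (S : Ctx V) :
    Adm lab link (S.fill T) (S.fill U) K₀ := by
  induction S with
  | hole => exact h
  | tensLeft S B ih => exact ih.tensLeft B
  | tensRight B S ih => exact ih.tensRight B
  | parLeft S B ih => exact ih.parLeft B
  | parRight B S ih => exact ih.parRight B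

theorem iDown (X Y : FTree V) : Adm lab link Y (.tens (.par (X.dual link) X) Y) 0 := fun G K h =>
  (((Seq.identity X).par (G := 0)).tens h).congr (by simp) (by simp)

theorem iUp {X X' : FTree V} (hd : X'.map lab = Formula.neg (X.map lab)) (Y : FTree V) :
    Adm lab link (.par Y (.tens X X')) Y {(X, X')} := fun _ _ h =>
  Seq.tens_to_cut hd (h.par_inv.congr (Multiset.cons_swap _ _ _) rfl)

theorem comDown (X Y : FTree V) : Adm lab link (.par X Y) (.par Y X) 0 := fun _ _ h =>
  (h.par_inv.congr (Multiset.cons_swap _ _ _) (zero_add _)).par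

theorem comUp (X Y : FTree V) : Adm lab link (.tens X Y) (.tens Y X) 0 := fun _ _ h =>
  Seq.tens_elim (W := {.tens Y X}) (fun _ _ _ _ h₁ h₂ =>
    (h₂.tens h₁).congr (by rw [Multiset.singleton_add, add_comm]) (by abel)) h

theorem assDown (X Y Z : FTree V) :
    Adm lab link (.par X (.par Y Z)) (.par (.par X Y) Z) 0 := fun G _ h => by
  refine (Seq.par (Seq.par ((Seq.par_inv (X := Y) (Y := Z) (G := X ::ₘ G)
    (h.par_inv.congr ?_ rfl)).congr ?_ (zero_add _))))
  all_goals try simp only [← Multiset.singleton_add]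
  all_goals abel

/-- Both tensors are traced to their premises, the inner one inside the second premise of the outer
one. The context `G₁` and the cuts `K₁` of the first premise are carried along as part of the
replacement. -/
theorem assUp (X Y Z : FTree V) :
    Adm lab link (.tens X (.tens Y Z)) (.tens (.tens X Y) Z) 0 := fun _ _ h =>
  Seq.tens_elim (W := {.tens (.tens X Y) Z}) (fun G₁ _ K₁ _ h₁ h₂ =>
    (Seq.tens_elim (W := .tens (.tens X Y) Z ::ₘ G₁) (K₀ := K₁) (fun _ _ _ _ h₃ h₄ =>
      ((h₁.tens h₃).tens h₄).congr (by simp only [← Multiset.singleton_add]; abel) (by abel))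
        h₂).congr (by simp only [← Multiset.singleton_add]; abel) (by abel)) h

/-- Once the ⅋ is inverted in the second premise, `Z` is a side formula there, hence also beside the
⊗ of `X` and `Y`. -/
theorem switch (X Y Z : FTree V) :
    Adm lab link (.tens X (.par Y Z)) (.par (.tens X Y) Z) 0 := fun _ _ h =>
  Seq.tens_elim (W := {.par (.tens X Y) Z}) (fun G₁ G₂ K₁ _ h₁ h₂ => by
    refine (Seq.par (X := .tens X Y) (Y := Z) (G := G₁ + G₂)
      ((h₁.tens h₂.par_inv).congr ?_ rfl)).congr ?_ (zero_add _)
    all_goals try simp only [← Multiset.singleton_add]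
    all_goals abel) h

end Adm

end Seq

/-! ### Sequent proofs in both directions, and soundness of the calculus of structures. -/

section Translations

variable {V : Type*} {lab : V → Atom} {link : V → V}

theorem FTree.map_dual (hl : ∀ v, lab (link v) = (lab v).dual) (X : FTree V) :
    (X.dual link).map lab = Formula.neg (X.map lab) := by
  induction X with
  | leaf v => simp [FTree.dual, FTree.map, Formula.neg, hl]
  | tens A B hA hB => simp_all [FTree.dual, FTree.map, Formula.neg]
  | par A B hA hB => simp_all [FTree.dual, FTree.map, Formula.neg]

theorem Ctx.map_fill {α β : Type*} (f : α → β) (S : Ctx α) (T : FTree α) :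
    (S.fill T).map f = (S.map f).fill (T.map f) := by
  induction S <;> simp_all [Ctx.fill, Ctx.map, FTree.map]

/-! ### Sequent calculus -/

theorem SCProof.Traces.seq {Γ : List Formula} {P : SCProof Γ} {G : List (FTree V)}
    {K : List (FTree V × FTree V)} (h : P.Traces lab link G K) :
    Seq lab link (G : Multiset (FTree V)) (K : Cuts V) := by
  induction P generalizing G K with
  | id A =>
    obtain ⟨X, -, rfl, rfl⟩ := h
    exact Seq.identity X
  | exch Γ Δ A B P ih =>
    obtain ⟨G₁, G₂, X, Y, -, -, -, -, rfl, h⟩ := h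
    refine (ih h).congr (Multiset.coe_eq_coe.2 ?_) rfl
    exact (List.Perm.swap _ _ _).append_left _
  | par Γ Δ A B P ih =>
    obtain ⟨G₁, G₂, X, Y, -, -, -, -, rfl, h⟩ := h
    refine (Seq.par (X := X) (Y := Y) (G := ↑(G₁ ++ G₂)) ((ih h).congr ?_ rfl)).congr ?_ rfl
    all_goals simp only [← Multiset.coe_add, ← Multiset.cons_coe, ← Multiset.singleton_add]
    all_goals abel
  | tens Γ Δ A B P Q ihP ihQ =>
    obtain ⟨G₁, G₂, X, Y, K₁, K₂, -, -, -, -, rfl, rfl, h₁, h₂⟩ := h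
    refine (Seq.tens (X := X) (Y := Y) (G₁ := ↑G₁) (G₂ := ↑G₂) ((ihP h₁).congr ?_ rfl)
      ((ihQ h₂).congr rfl rfl)).congr ?_ (by simp)
    all_goals simp only [← Multiset.coe_add, ← Multiset.cons_coe, ← Multiset.singleton_add,
      Multiset.coe_nil, add_zero]
    all_goals abel
  | cut Γ Δ A P Q ihP ihQ =>
    obtain ⟨G₁, G₂, X, Y, K₁, K₂, -, -, hX, hY, rfl, rfl, h₁, h₂⟩ := h
    refine (Seq.cut (X := X) (Y := Y) (G₁ := ↑G₁) (G₂ := ↑G₂) (by rw [hY, hX])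
      ((ihP h₁).congr ?_ rfl) ((ihQ h₂).congr rfl rfl)).congr ?_ ?_
    all_goals simp only [← Multiset.coe_add, ← Multiset.cons_coe, ← Multiset.singleton_add,
      Multiset.coe_nil, add_zero]
    all_goals abel

/-- The sequent in the type of a proof is determined by the named conclusion; this allows traced
proofs to be fed into rules that demand a sequent of a specific shape. -/
theorem SCProof.Traces.map_eq (hl : ∀ v, lab (link v) = (lab v).dual) {Γ : List Formula}
    {P : SCProof Γ} {G : List (FTree V)} {K : List (FTree V × FTree V)}
    (h : P.Traces lab link G K) : G.map (FTree.map lab) = Γ := by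
  cases P with
  | id A =>
    obtain ⟨X, rfl, rfl, rfl⟩ := h
    simp [FTree.map_dual hl]
  | exch Γ Δ A B P =>
    obtain ⟨G₁, G₂, X, Y, rfl, rfl, rfl, rfl, rfl, h⟩ := h
    simp
  | par Γ Δ A B P =>
    obtain ⟨G₁, G₂, X, Y, rfl, rfl, rfl, rfl, rfl, h⟩ := h
    simp [FTree.map]
  | tens Γ Δ A B P Q =>
    obtain ⟨G₁, G₂, X, Y, K₁, K₂, rfl, rfl, rfl, rfl, rfl, rfl, h₁, h₂⟩ := h
    simp [FTree.map]
  | cut Γ Δ A P Q =>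
    obtain ⟨G₁, G₂, X, Y, K₁, K₂, rfl, rfl, hX, hY, rfl, rfl, h₁, h₂⟩ := h
    simp

/-- There is a sequent calculus proof whose conclusion is named as `G` and whose cuts are `K`. -/
def SCDerivable (lab : V → Atom) (link : V → V) (G : List (FTree V)) (K : Cuts V) : Prop :=
  ∃ (Γ : List Formula) (P : SCProof Γ) (K' : List (FTree V × FTree V)),
    P.Traces lab link G K' ∧ (K' : Cuts V) = K

namespace SCDerivable

theorem exch (hl : ∀ v, lab (link v) = (lab v).dual) {G₁ G₂ : List (FTree V)} {X Y : FTree V}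
    {K : Cuts V} (h : SCDerivable lab link (G₁ ++ X :: Y :: G₂) K) :
    SCDerivable lab link (G₁ ++ Y :: X :: G₂) K := by
  obtain ⟨Γ, P, K', h, hK⟩ := h
  obtain rfl := h.map_eq hl
  revert P
  rw [List.map_append, List.map_cons, List.map_cons]
  intro P h
  exact ⟨_, .exch _ _ _ _ P, K', ⟨G₁, G₂, X, Y, rfl, rfl, rfl, rfl, rfl, h⟩, hK⟩

theorem perm (hl : ∀ v, lab (link v) = (lab v).dual) {G G' : List (FTree V)} (hG : G.Perm G')
    {K : Cuts V} (h : SCDerivable lab link G K) : SCDerivable lab link G' K := by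
  -- The prefix `L` makes room for exchanges behind formulas that stay in place, as the `cons` case
  -- requires.
  suffices ∀ L, SCDerivable lab link (L ++ G) K → SCDerivable lab link (L ++ G') K from this [] h
  clear h
  induction hG with
  | nil => exact fun _ h => h
  | cons x _ ih => exact fun L h => by simpa using ih (L ++ [x]) (by simpa using h)
  | swap x y l => exact fun L h => h.exch hl
  | trans _ _ ih₁ ih₂ => exact fun L h => ih₂ L (ih₁ L h)

end SCDerivable

/-- In each case the premises are listed in the order that the list rule expects, and exchanges then
produce the required order `L` of the conclusion. -/
theorem Seq.scDerivable (hl : ∀ v, lab (link v) = (lab v).dual) {G : Multiset (FTree V)}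
    {K : Cuts V} (h : Seq lab link G K) (L : List (FTree V)) (hL : (L : Multiset (FTree V)) = G) :
    SCDerivable lab link L K := by
  induction h generalizing L with
  | ax v =>
    refine SCDerivable.perm hl (G := [leaf (link v), leaf v])
      (Multiset.coe_eq_coe.1 (by rw [hL]; rfl)) ?_
    exact ⟨_, .id (.leaf (lab v)), [], ⟨leaf v, rfl, rfl, rfl⟩, rfl⟩
  | @par X Y G K h ih =>
    obtain ⟨G, rfl⟩ := Quot.exists_rep G
    obtain ⟨Γ, P, K', h, hK⟩ := ih (X :: Y :: G) rfl
    refine SCDerivable.perm hl (G := FTree.par X Y :: G)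
      (Multiset.coe_eq_coe.1 (by rw [hL]; rfl)) ?_
    obtain rfl := h.map_eq hl
    exact ⟨_, .par [] (G.map (FTree.map lab)) _ _ P, K',
      ⟨[], G, X, Y, rfl, rfl, rfl, rfl, rfl, h⟩, hK⟩
  | @tens X Y G₁ G₂ K₁ K₂ _ _ ih₁ ih₂ =>
    obtain ⟨G₁, rfl⟩ := Quot.exists_rep G₁
    obtain ⟨G₂, rfl⟩ := Quot.exists_rep G₂
    obtain ⟨Γ₁, P₁, K₁', h₁, rfl⟩ := ih₁ (G₁ ++ [X])
      (Multiset.coe_eq_coe.2 (List.perm_append_singleton _ _))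
    obtain ⟨Γ₂, P₂, K₂', h₂, rfl⟩ := ih₂ (Y :: G₂) rfl
    refine SCDerivable.perm hl (G := G₁ ++ FTree.tens X Y :: G₂)
      (Multiset.coe_eq_coe.1 (by rw [hL]; exact Multiset.coe_eq_coe.2 List.perm_middle)) ?_
    obtain rfl := h₁.map_eq hl
    obtain rfl := h₂.map_eq hl
    revert P₁
    rw [List.map_append]
    intro P₁ h₁
    exact ⟨_, .tens _ _ _ _ P₁ P₂, K₁' ++ K₂',
      ⟨G₁, G₂, X, Y, K₁', K₂', rfl, rfl, rfl, rfl, rfl, rfl, h₁, h₂⟩, by simp⟩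
  | @cut X Y G₁ G₂ K₁ K₂ hd _ _ ih₁ ih₂ =>
    obtain ⟨G₁, rfl⟩ := Quot.exists_rep G₁
    obtain ⟨G₂, rfl⟩ := Quot.exists_rep G₂
    obtain ⟨Γ₁, P₁, K₁', h₁, rfl⟩ := ih₁ (G₁ ++ [X])
      (Multiset.coe_eq_coe.2 (List.perm_append_singleton _ _))
    obtain ⟨Γ₂, P₂, K₂', h₂, rfl⟩ := ih₂ (Y :: G₂) rfl
    refine SCDerivable.perm hl (G := G₁ ++ G₂)
      (Multiset.coe_eq_coe.1 (by rw [hL]; rfl)) ?_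
    obtain rfl := h₁.map_eq hl
    obtain rfl := h₂.map_eq hl
    revert P₁ P₂
    rw [List.map_append, List.map_cons (l := G₂), hd]
    intro P₁ h₁ P₂ h₂
    exact ⟨_, .cut _ _ _ P₁ P₂, (X, Y) :: (K₁' ++ K₂'),
      ⟨G₁, G₂, X, Y, K₁', K₂', rfl, rfl, rfl, hd, rfl, rfl, h₁, h₂⟩, by simp⟩

/-! ### Calculus of structures: soundness -/

theorem DeepRule.Traces.adm {A B : Formula} {r : DeepRule A B} {T U : FTree V}
    {K : List (FTree V × FTree V)} (h : r.Traces lab link T U K) : Adm lab link T U K := by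
  cases r with
  | iDown A B =>
    obtain ⟨X, Y, -, -, rfl, rfl, rfl⟩ := h
    exact Adm.iDown _ _
  | iUp A B =>
    obtain ⟨X, X', Y, hX, hX', -, rfl, rfl, rfl⟩ := h
    exact Adm.iUp (by rw [hX', hX]) _
  | comDown A B =>
    obtain ⟨X, Y, -, -, rfl, rfl, rfl⟩ := h
    exact Adm.comDown _ _
  | comUp A B =>
    obtain ⟨X, Y, -, -, rfl, rfl, rfl⟩ := h
    exact Adm.comUp _ _
  | assDown A B C =>
    obtain ⟨X, Y, Z, -, -, -, rfl, rfl, rfl⟩ := h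
    exact Adm.assDown _ _ _
  | assUp A B C =>
    obtain ⟨X, Y, Z, -, -, -, rfl, rfl, rfl⟩ := h
    exact Adm.assUp _ _ _
  | switch A B C =>
    obtain ⟨X, Y, Z, -, -, -, rfl, rfl, rfl⟩ := h
    exact Adm.switch _ _ _

theorem CoSProof.Traces.seq {F : Option Formula} {P : CoSProof F} {G : Option (FTree V)}
    {K : List (FTree V × FTree V)} (h : P.Traces lab link G K) :
    Seq lab link (G.toList : Multiset (FTree V)) (K : Cuts V) := by
  induction P generalizing G K with
  | start A =>
    obtain ⟨X, -, rfl, rfl⟩ := h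
    exact (Seq.identity X).par (G := 0)
  | step S r P ih =>
    obtain ⟨S', T, U, K₁, K₂, -, hr, rfl, rfl, h⟩ := h
    exact (hr.adm.fill S' 0 _ (ih h)).congr rfl (by simp)
  | refute A P ih =>
    obtain ⟨X, X', K', hX, hX', rfl, rfl, h⟩ := h
    exact Seq.tens_to_cut (G := 0) (by rw [hX', hX]) (ih h)

/-- Repeated inversion of ⅋; the context `G` collects the formulas that have already been split off.
-/
theorem Seq.of_bigPar {L : List (FTree V)} {G : Multiset (FTree V)} {K : Cuts V}
    (h : Seq lab link (((bigPar L).toList : Multiset (FTree V)) + G) K) : Seq lab link (L + G) K := by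
  induction L generalizing G with
  | nil => exact h
  | cons A L ih =>
    rw [bigPar] at h
    cases hB : bigPar L with
    | none =>
      rw [hB] at h
      refine (ih (G := A ::ₘ G) (by simpa [hB] using h)).congr ?_ rfl
      simp only [← Multiset.cons_coe, ← Multiset.singleton_add]; abel
    | some B =>
      rw [hB] at h
      have h' : Seq lab link (FTree.par A B ::ₘ G) K := by simpa using h
      refine (ih (G := A ::ₘ G) (h'.par_inv.congr ?_ rfl)).congr ?_ rfl
      · simp only [hB, Option.toList_some, Multiset.coe_singleton, ← Multiset.singleton_add]; abel
      · simp only [← Multiset.cons_coe, ← Multiset.singleton_add]; abel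

end Translations

/-! ### Completeness of the calculus of structures. -/

section Structures

variable {V : Type*} {lab : V → Atom} {link : V → V}

/-- Named instances of the deep rules. -/
inductive DStep (lab : V → Atom) (link : V → V) : FTree V → FTree V → Cuts V → Prop
  | iDown (X Y : FTree V) : DStep lab link Y (.tens (.par (X.dual link) X) Y) 0
  | iUp (X X' Y : FTree V) : X'.map lab = Formula.neg (X.map lab) →
      DStep lab link (.par Y (.tens X X')) Y {(X, X')}
  | comDown (X Y : FTree V) : DStep lab link (.par X Y) (.par Y X) 0
  | comUp (X Y : FTree V) : DStep lab link (.tens X Y) (.tens Y X) 0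
  | assDown (X Y Z : FTree V) : DStep lab link (.par X (.par Y Z)) (.par (.par X Y) Z) 0
  | switch (X Y Z : FTree V) : DStep lab link (.tens X (.par Y Z)) (.par (.tens X Y) Z) 0

/-- Named formulas, with their cuts, which are provable in the calculus of structures. -/
inductive CoSProvable (lab : V → Atom) (link : V → V) : FTree V → Cuts V → Prop
  | start (X : FTree V) : CoSProvable lab link (.par (X.dual link) X) 0
  | step (S : Ctx V) {T U : FTree V} {K₁ K₂ : Cuts V} : DStep lab link T U K₁ →
      CoSProvable lab link (S.fill T) K₂ → CoSProvable lab link (S.fill U) (K₁ + K₂)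

theorem DStep.exists_traces (hl : ∀ v, lab (link v) = (lab v).dual) {T U : FTree V} {K : Cuts V}
    (h : DStep lab link T U K) :
    ∃ (r : DeepRule (T.map lab) (U.map lab)) (K' : List (FTree V × FTree V)),
      r.Traces lab link T U K' ∧ (K' : Cuts V) = K := by
  cases h with
  | iDown X Y =>
    rw [show (FTree.tens (.par (X.dual link) X) T).map lab =
      .tens (.par (Formula.neg (X.map lab)) (X.map lab)) (T.map lab) by
        simp [FTree.map, FTree.map_dual hl]]
    exact ⟨.iDown _ _, [], ⟨X, T, rfl, rfl, rfl, rfl, rfl⟩, rfl⟩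
  | iUp X X' Y hd =>
    rw [show (FTree.par U (.tens X X')).map lab =
      .par (U.map lab) (.tens (X.map lab) (Formula.neg (X.map lab))) by simp [FTree.map, hd]]
    exact ⟨.iUp _ _, [(X, X')], ⟨X, X', U, rfl, hd, rfl, rfl, rfl, rfl⟩, rfl⟩
  | comDown X Y => exact ⟨.comDown _ _, [], ⟨X, Y, rfl, rfl, rfl, rfl, rfl⟩, rfl⟩
  | comUp X Y => exact ⟨.comUp _ _, [], ⟨X, Y, rfl, rfl, rfl, rfl, rfl⟩, rfl⟩
  | assDown X Y Z =>
    exact ⟨.assDown _ _ _, [], ⟨X, Y, Z, rfl, rfl, rfl, rfl, rfl, rfl⟩, rfl⟩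
  | switch X Y Z =>
    exact ⟨.switch _ _ _, [], ⟨X, Y, Z, rfl, rfl, rfl, rfl, rfl, rfl⟩, rfl⟩

namespace CoSProvable

theorem exists_traces (hl : ∀ v, lab (link v) = (lab v).dual) {T : FTree V} {K : Cuts V}
    (h : CoSProvable lab link T K) :
    ∃ (P : CoSProof (some (T.map lab))) (K' : List (FTree V × FTree V)),
      P.Traces lab link (some T) K' ∧ (K' : Cuts V) = K := by
  induction h with
  | start X =>
    rw [show (FTree.par (X.dual link) X).map lab = .par (Formula.neg (X.map lab)) (X.map lab) by
      simp [FTree.map, FTree.map_dual hl]]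
    exact ⟨.start _, [], ⟨X, rfl, rfl, rfl⟩, rfl⟩
  | @step S T U K₁ K₂ hs _ ih =>
    obtain ⟨P, K₂', hP, rfl⟩ := ih
    obtain ⟨r, K₁', hr, rfl⟩ := hs.exists_traces hl
    revert P
    rw [Ctx.map_fill, Ctx.map_fill]
    intro P hP
    exact ⟨.step _ r P, K₁' ++ K₂', ⟨S, T, U, K₁', K₂', rfl, hr, rfl, rfl, hP⟩, by simp⟩

theorem congr {T : FTree V} {K K' : Cuts V} (h : CoSProvable lab link T K) (hK : K' = K) :
    CoSProvable lab link T K' := hK ▸ h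

/-- The proof of `T` is replayed to the left of `U`, beneath the proof of `U`: its initial `i↓`
becomes an instance of `i↓` with side formula `U`, and every later step takes place in a larger
context. -/
theorem tens {T U : FTree V} {K₁ K₂ : Cuts V} (hT : CoSProvable lab link T K₁)
    (hU : CoSProvable lab link U K₂) : CoSProvable lab link (.tens T U) (K₁ + K₂) := by
  induction hT with
  | start X => exact step .hole (.iDown X U) hU
  | step S hs _ ih => exact (step (.tensLeft S U) hs ih).congr (add_assoc _ _ _)

end CoSProvable

/-- Derivability in the calculus of structures, without new cuts. -/
def Der (lab : V → Atom) (link : V → V) (T U : FTree V) : Prop :=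
  ∀ (S : Ctx V) (K : Cuts V), CoSProvable lab link (S.fill T) K → CoSProvable lab link (S.fill U) K

/-- Plugging a context into a context. -/
def Ctx.comp {α : Type*} : Ctx α → Ctx α → Ctx α
  | hole, R => R
  | tensLeft S B, R => tensLeft (comp S R) B
  | tensRight B S, R => tensRight B (comp S R)
  | parLeft S B, R => parLeft (comp S R) B
  | parRight B S, R => parRight B (comp S R)

theorem Ctx.comp_fill {α : Type*} (S R : Ctx α) (T : FTree α) :
    (S.comp R).fill T = S.fill (R.fill T) := by
  induction S <;> simp_all [Ctx.comp, Ctx.fill]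

namespace Der

theorem refl (T : FTree V) : Der lab link T T := fun _ _ h => h

theorem trans {T U W : FTree V} (h : Der lab link T U) (h' : Der lab link U W) :
    Der lab link T W := fun S K hT => h' S K (h S K hT)

theorem of_step {T U : FTree V} (h : DStep lab link T U 0) : Der lab link T U := fun S _ hT =>
  (CoSProvable.step S h hT).congr (zero_add _).symm

theorem fill {T U : FTree V} (h : Der lab link T U) (R : Ctx V) :
    Der lab link (R.fill T) (R.fill U) := fun S K hT => by
  rw [← Ctx.comp_fill] at hT ⊢
  exact h _ _ hT

theorem parLeft {T U : FTree V} (h : Der lab link T U) (B : FTree V) :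
    Der lab link (.par T B) (.par U B) := h.fill (.parLeft .hole B)

theorem parRight {T U : FTree V} (h : Der lab link T U) (B : FTree V) :
    Der lab link (.par B T) (.par B U) := h.fill (.parRight B .hole)

theorem parComm (X Y : FTree V) : Der lab link (.par X Y) (.par Y X) := of_step (.comDown X Y)

theorem tensComm (X Y : FTree V) : Der lab link (.tens X Y) (.tens Y X) := of_step (.comUp X Y)

theorem parAssoc (X Y Z : FTree V) : Der lab link (.par X (.par Y Z)) (.par (.par X Y) Z) :=
  of_step (.assDown X Y Z)

/-- Only one direction of associativity is a rule; commutativity yields the other. -/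
theorem parAssoc' (X Y Z : FTree V) : Der lab link (.par (.par X Y) Z) (.par X (.par Y Z)) :=
  (parComm _ _).trans <| (parAssoc _ _ _).trans <| (parComm _ _).trans <| (parAssoc _ _ _).trans
    (parComm _ _)

theorem switch (X Y Z : FTree V) : Der lab link (.tens X (.par Y Z)) (.par (.tens X Y) Z) :=
  of_step (.switch X Y Z)

theorem provable {T U : FTree V} (h : Der lab link T U) {K : Cuts V}
    (hT : CoSProvable lab link T K) : CoSProvable lab link U K := h .hole K hT

end Der

/-- `T` is a `⅋` of the elements of a multiset in some order and bracketing. -/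
inductive IsPar : FTree V → Multiset (FTree V) → Prop
  | single (X : FTree V) : IsPar X {X}
  | par {T U : FTree V} {M N : Multiset (FTree V)} :
      IsPar T M → IsPar U N → IsPar (.par T U) (M + N)

namespace IsPar

theorem congr {T : FTree V} {M M' : Multiset (FTree V)} (h : IsPar T M) (hM : M' = M) :
    IsPar T M' := hM ▸ h

theorem ne_zero {T : FTree V} {M : Multiset (FTree V)} (h : IsPar T M) : M ≠ 0 := by
  induction h with
  | single X => simp
  | par _ _ ih _ => simp [ih]

theorem eq_of_singleton {T X : FTree V} (h : IsPar T {X}) : T = X := by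
  generalize hM : ({X} : Multiset (FTree V)) = M at h
  cases h with
  | single Y => exact (Multiset.singleton_inj.1 hM).symm
  | par h₁ h₂ =>
    have h := congrArg Multiset.card hM
    have h₁ := Multiset.card_pos.2 h₁.ne_zero
    have h₂ := Multiset.card_pos.2 h₂.ne_zero
    simp at h
    omega

/-- Any element of the multiset can be moved to the front. -/
theorem exists_front {T : FTree V} {M : Multiset (FTree V)} (h : IsPar T M) {X : FTree V}
    {M' : Multiset (FTree V)} (hM : M = X ::ₘ M') (hM' : M' ≠ 0) :
    ∃ T', IsPar T' M' ∧ Der lab link T (.par X T') ∧ Der lab link (.par X T') T := by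
  induction h generalizing M' with
  | single Y =>
    have := congrArg Multiset.card hM
    simp at this
    exact absurd this hM'
  | @par T U M N hT hU ihT ihU =>
    have hm : X ∈ M + N := by simp [hM]
    obtain hm | hm := Multiset.mem_add.1 hm
    · obtain ⟨M, rfl⟩ := Multiset.exists_cons_of_mem hm
      rw [Multiset.cons_add, Multiset.cons_inj_right] at hM
      subst hM
      by_cases h0 : M = 0
      · subst h0
        obtain rfl := hT.eq_of_singleton
        exact ⟨U, hU.congr (by simp), Der.refl _, Der.refl _⟩
      · obtain ⟨T', hT', h₁, h₂⟩ := ihT rfl h0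
        exact ⟨.par T' U, hT'.par hU, (h₁.parLeft U).trans (Der.parAssoc' _ _ _),
          (Der.parAssoc _ _ _).trans (h₂.parLeft U)⟩
    · obtain ⟨N, rfl⟩ := Multiset.exists_cons_of_mem hm
      rw [Multiset.add_cons, Multiset.cons_inj_right] at hM
      subst hM
      by_cases h0 : N = 0
      · subst h0
        obtain rfl := hU.eq_of_singleton
        exact ⟨T, hT.congr (by simp), Der.parComm _ _, Der.parComm _ _⟩
      · obtain ⟨T', hT', h₁, h₂⟩ := ihU rfl h0
        refine ⟨.par T T', hT.par hT', ?_, ?_⟩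
        · exact (h₁.parRight T).trans <| (Der.parAssoc _ _ _).trans <|
            ((Der.parComm _ _).parLeft _).trans (Der.parAssoc' _ _ _)
        · exact (Der.parAssoc _ _ _).trans <| ((Der.parComm _ _).parLeft _).trans <|
            (Der.parAssoc' _ _ _).trans (h₂.parRight T)

/-- The same element is brought to the front on both sides, and the remainders are treated by
induction. The backward derivation in `exists_front` is what leads from the common form to `U`. -/
theorem der {T U : FTree V} {M : Multiset (FTree V)} (hT : IsPar T M) (hU : IsPar U M) :
    Der lab link T U := by
  induction M using Multiset.induction generalizing T U with
  | empty => exact absurd rfl hT.ne_zero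
  | cons X M ih =>
    by_cases h0 : M = 0
    · subst h0
      obtain rfl := hT.eq_of_singleton
      obtain rfl := hU.eq_of_singleton
      exact Der.refl _
    · obtain ⟨T', hT', h₁, -⟩ := hT.exists_front (lab := lab) (link := link) rfl h0
      obtain ⟨U', hU', -, h₂⟩ := hU.exists_front (lab := lab) (link := link) rfl h0
      exact h₁.trans (((ih hT' hU').parRight X).trans h₂)

theorem of_bigPar {L : List (FTree V)} {T : FTree V} (h : bigPar L = some T) : IsPar T L := by
  induction L generalizing T with
  | nil => cases h
  | cons A L ih =>
    rw [bigPar] at h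
    cases hB : bigPar L with
    | none =>
      have : L = [] := by
        cases L with
        | nil => rfl
        | cons B L => rw [bigPar] at hB; cases h' : bigPar L <;> simp [h'] at hB
      subst this
      obtain rfl : A = T := by simpa [hB] using h
      exact single A
    | some B =>
      obtain rfl : FTree.par A B = T := by simpa [hB] using h
      exact ((single A).par (ih hB)).congr (by simp)

end IsPar

/-- `X ⅋ g`, or `X` if there is no `g`. -/
def FTree.parOpt (X : FTree V) : Option (FTree V) → FTree V
  | none => X
  | some g => .par X g

/-- `IsPar` for possibly empty multisets. -/
def IsParOpt : Option (FTree V) → Multiset (FTree V) → Prop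
  | none, M => M = 0
  | some g, M => IsPar g M

namespace IsParOpt

theorem exists_of (M : Multiset (FTree V)) : ∃ g, IsParOpt g M := by
  induction M using Multiset.induction with
  | empty => exact ⟨none, rfl⟩
  | cons X M ih =>
    obtain ⟨g | g, h⟩ := ih
    · exact ⟨some X, by obtain rfl := h; exact .single X⟩
    · exact ⟨some (.par X g), (IsPar.single X).par h⟩

theorem parOpt {T : FTree V} {g : Option (FTree V)} {M N : Multiset (FTree V)} (hT : IsPar T M)
    (h : IsParOpt g N) : IsPar (T.parOpt g) (M + N) := by
  cases g with
  | none => obtain rfl := h; exact hT.congr (add_zero M)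
  | some g => exact hT.par h

end IsParOpt

theorem Der.tens_parOpt_right (X Y : FTree V) (g : Option (FTree V)) :
    Der lab link (.tens X (Y.parOpt g)) ((FTree.tens X Y).parOpt g) := by
  cases g with
  | none => exact Der.refl _
  | some g => exact Der.switch X Y g

theorem Der.parOpt {T U : FTree V} (h : Der lab link T U) (g : Option (FTree V)) :
    Der lab link (T.parOpt g) (U.parOpt g) := by
  cases g with
  | none => exact h
  | some g => exact h.parLeft g

/-- Two switches, with commutativity of ⊗ around the second one: first `g₂` leaves the ⊗, then `g₁`.
-/
theorem Der.tens_parOpt (X Y : FTree V) (g₁ g₂ : Option (FTree V)) :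
    Der lab link (.tens (X.parOpt g₁) (Y.parOpt g₂)) (((FTree.tens X Y).parOpt g₁).parOpt g₂) :=
  (Der.tens_parOpt_right _ _ _).trans <| Der.parOpt ((Der.tensComm _ _).trans <|
    (Der.tens_parOpt_right _ _ _).trans <| Der.parOpt (Der.tensComm _ _) _) _

/-- Provability in the calculus of structures of a possibly empty `⅋`. -/
def CoSProvableList (lab : V → Atom) (link : V → V) (G : Multiset (FTree V)) (K : Cuts V) : Prop :=
  (∀ T, IsPar T G → CoSProvable lab link T K) ∧
    (G = 0 → ∃ X X' K', X'.map lab = Formula.neg (X.map lab) ∧ K = (X, X') ::ₘ K' ∧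
      CoSProvable lab link (.tens X X') K')

theorem CoSProvableList.of_isPar {T : FTree V} {G : Multiset (FTree V)} {K : Cuts V}
    (hT : IsPar T G) (h : CoSProvable lab link T K) : CoSProvableList lab link G K :=
  ⟨fun _ hU => (hT.der hU).provable h, fun h0 => absurd h0 hT.ne_zero⟩

theorem Seq.coSProvableList {G : Multiset (FTree V)} {K : Cuts V} (h : Seq lab link G K) :
    CoSProvableList lab link G K := by
  -- The part common to the ⊗-rule and the cut rule: for a cut, the tensor produced here is
  -- afterwards consumed by `i↑`.
  have key : ∀ {X Y : FTree V} {g₁ g₂ : Option (FTree V)} {G₁ G₂ : Multiset (FTree V)}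
      {K₁ K₂ : Cuts V}, IsParOpt g₁ G₁ → IsParOpt g₂ G₂ →
      CoSProvableList lab link (X ::ₘ G₁) K₁ → CoSProvableList lab link (Y ::ₘ G₂) K₂ →
      CoSProvable lab link (((FTree.tens X Y).parOpt g₁).parOpt g₂) (K₁ + K₂) :=
    fun {X Y _ _ _ _ _ _} hg₁ hg₂ h₁ h₂ => (Der.tens_parOpt _ _ _ _).provable
      ((h₁.1 _ (IsParOpt.parOpt (.single X) hg₁)).tens (h₂.1 _ (IsParOpt.parOpt (.single Y) hg₂)))
  induction h with
  | ax v => exact .of_isPar (.par (.single _) (.single _)) (CoSProvable.start (leaf v))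
  | @par X Y G K _ ih =>
    obtain ⟨g, hg⟩ := IsParOpt.exists_of G
    exact .of_isPar (IsParOpt.parOpt (.single (.par X Y)) hg)
      (ih.1 _ ((IsParOpt.parOpt (.par (.single X) (.single Y)) hg).congr (by simp)))
  | @tens X Y G₁ G₂ K₁ K₂ _ _ ih₁ ih₂ =>
    obtain ⟨g₁, hg₁⟩ := IsParOpt.exists_of G₁
    obtain ⟨g₂, hg₂⟩ := IsParOpt.exists_of G₂
    exact .of_isPar ((IsParOpt.parOpt (IsParOpt.parOpt (.single (.tens X Y)) hg₁) hg₂).congr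
      (by rw [add_assoc, Multiset.singleton_add])) (key hg₁ hg₂ ih₁ ih₂)
  | @cut X Y G₁ G₂ K₁ K₂ hd _ _ ih₁ ih₂ =>
    obtain ⟨g₁, hg₁⟩ := IsParOpt.exists_of G₁
    obtain ⟨g₂, hg₂⟩ := IsParOpt.exists_of G₂
    have h := key hg₁ hg₂ ih₁ ih₂
    obtain ⟨g | g, hg⟩ := IsParOpt.exists_of (G₁ + G₂)
    -- Without side formulas there is no `B` for `i↑` to leave behind, so this is the
    -- conclusion-free form, for which the proof of `X ⊗ Y` itself is recorded.
    · obtain ⟨rfl, rfl⟩ := add_eq_zero.1 (show G₁ + G₂ = 0 from hg)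
      have h₁ : g₁ = none := by cases g₁ with | none => rfl | some g => exact absurd rfl hg₁.ne_zero
      have h₂ : g₂ = none := by cases g₂ with | none => rfl | some g => exact absurd rfl hg₂.ne_zero
      subst h₁ h₂
      exact ⟨fun T hT => absurd (zero_add 0) hT.ne_zero, fun _ => ⟨X, Y, _, hd, rfl, h⟩⟩
    · refine .of_isPar hg ((CoSProvable.step .hole (.iUp X Y g hd)
        (((IsParOpt.parOpt (IsParOpt.parOpt (.single (.tens X Y)) hg₁) hg₂).der
          ((IsPar.par hg (.single (.tens X Y))).congr ?_)).provable h)).congr (by simp))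
      rw [add_assoc, add_comm]

theorem Seq.exists_coSProof (hl : ∀ v, lab (link v) = (lab v).dual) {L : List (FTree V)}
    {K : Cuts V} (h : Seq lab link L K) :
    ∃ (F : Option Formula) (P : CoSProof F) (K' : List (FTree V × FTree V)),
      P.Traces lab link (bigPar L) K' ∧ (K' : Cuts V) = K := by
  have h := h.coSProvableList
  cases hL : bigPar L with
  | none =>
    have : L = [] := by
      cases L with
      | nil => rfl
      | cons B L => rw [bigPar] at hL; cases h' : bigPar L <;> simp [h'] at hL
    subst this
    obtain ⟨X, X', K', hd, rfl, hc⟩ := h.2 rfl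
    obtain ⟨P, K', hP, rfl⟩ := hc.exists_traces hl
    revert P
    rw [FTree.map, hd]
    intro P hP
    exact ⟨none, .refute _ P, (X, X') :: K', ⟨X, X', K', rfl, hd, rfl, rfl, hP⟩, rfl⟩
  | some T =>
    obtain ⟨P, K', hP, hK⟩ := (h.1 T (IsPar.of_bigPar hL)).exists_traces hl
    exact ⟨_, P, K', hP, hK⟩

end Structures

/-! ### Contracted switchings, and necessity of the criterion. -/

section Switchings

variable {α ι κ : Type*}

/-- `Sw T r E`: in some switching of `T`, the root is connected with the leaf `r` without using the
right edge of any `⊗`, and contracting all edges which are not right edges of some `⊗` leaves the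
edges `E` between leaves. -/
inductive Sw : FTree α → α → Multiset (α × α) → Prop
  | leaf (a : α) : Sw (leaf a) a 0
  | tens {A B : FTree α} {a b : α} {E F : Multiset (α × α)} :
      Sw A a E → Sw B b F → Sw (tens A B) a ((a, b) ::ₘ (E + F))
  | parLeft {A B : FTree α} {a b : α} {E F : Multiset (α × α)} :
      Sw A a E → Sw B b F → Sw (par A B) a (E + F)
  | parRight {A B : FTree α} {a b : α} {E F : Multiset (α × α)} :
      Sw A a E → Sw B b F → Sw (par A B) b (E + F)

/-- Switchings of a forest. -/
inductive SwF : Multiset (FTree α) → Multiset (α × α) → Prop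
  | zero : SwF 0 0
  | cons {A : FTree α} {a : α} {M : Multiset (FTree α)} {E F : Multiset (α × α)} :
      Sw A a E → SwF M F → SwF (A ::ₘ M) (E + F)

/-- The leaves of a forest. -/
def leavesM (M : Multiset (FTree α)) : Multiset α := M.bind fun T => (T.leaves : Multiset α)

/-- The number of `⊗`-nodes. -/
def FTree.tensCount : FTree α → ℕ
  | leaf _ => 0
  | tens A B => tensCount A + tensCount B + 1
  | par A B => tensCount A + tensCount B

/-- The number of inner nodes. -/
def FTree.innerCount : FTree α → ℕ
  | leaf _ => 0
  | tens A B => innerCount A + innerCount B + 1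
  | par A B => innerCount A + innerCount B + 1

/-- The number of `⊗`-nodes of a forest. -/
def tensCountM (M : Multiset (FTree α)) : ℕ := (M.map tensCount).sum

/-- The number of inner nodes of a forest. -/
def innerCountM (M : Multiset (FTree α)) : ℕ := (M.map innerCount).sum

@[simp] theorem leavesM_cons (A : FTree α) (M : Multiset (FTree α)) :
    leavesM (A ::ₘ M) = A.leaves + leavesM M := Multiset.cons_bind _ _ _

@[simp] theorem leavesM_singleton (A : FTree α) :
    leavesM ({A} : Multiset (FTree α)) = A.leaves := Multiset.singleton_bind _ _

@[simp] theorem leavesM_add (M N : Multiset (FTree α)) :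
    leavesM (M + N) = leavesM M + leavesM N := Multiset.add_bind _ _ _

@[simp] theorem tensCountM_cons (A : FTree α) (M : Multiset (FTree α)) :
    tensCountM (A ::ₘ M) = A.tensCount + tensCountM M := by simp [tensCountM]

@[simp] theorem tensCountM_add (M N : Multiset (FTree α)) :
    tensCountM (M + N) = tensCountM M + tensCountM N := by simp [tensCountM]

@[simp] theorem innerCountM_cons (A : FTree α) (M : Multiset (FTree α)) :
    innerCountM (A ::ₘ M) = A.innerCount + innerCountM M := by simp [innerCountM]

theorem Sw.exists_of (T : FTree α) : ∃ r E, Sw T r E := by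
  induction T with
  | leaf a => exact ⟨_, _, .leaf a⟩
  | tens A B ihA ihB =>
    obtain ⟨_, _, hA⟩ := ihA
    obtain ⟨_, _, hB⟩ := ihB
    exact ⟨_, _, .tens hA hB⟩
  | par A B ihA ihB =>
    obtain ⟨_, _, hA⟩ := ihA
    obtain ⟨_, _, hB⟩ := ihB
    exact ⟨_, _, .parLeft hA hB⟩

theorem Sw.mem_leaves {T : FTree α} {r : α} {E : Multiset (α × α)} (h : Sw T r E) :
    r ∈ T.leaves := by
  induction h <;> simp_all [leaves]

theorem Sw.card_eq {T : FTree α} {r : α} {E : Multiset (α × α)} (h : Sw T r E) :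
    Multiset.card E = T.tensCount := by
  induction h <;> simp_all [tensCount]

namespace SwF

theorem exists_of (M : Multiset (FTree α)) : ∃ F, SwF M F := by
  induction M using Multiset.induction with
  | empty => exact ⟨0, .zero⟩
  | cons A M ih =>
    obtain ⟨F, hF⟩ := ih
    obtain ⟨r, E, h⟩ := Sw.exists_of A
    exact ⟨_, .cons h hF⟩

theorem card_eq {M : Multiset (FTree α)} {F : Multiset (α × α)} (h : SwF M F) :
    Multiset.card F = tensCountM M := by
  induction h with
  | zero => rfl
  | cons h _ ih => simp [h.card_eq, ih]

theorem cons_inv {A : FTree α} {M : Multiset (FTree α)} {F : Multiset (α × α)}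
    (h : SwF (A ::ₘ M) F) : ∃ a E F', Sw A a E ∧ SwF M F' ∧ F = E + F' := by
  generalize hN : A ::ₘ M = N at h
  induction h generalizing M with
  | zero => simp at hN
  | @cons B b N E F hB hN' ih =>
    obtain ⟨rfl, rfl⟩ | ⟨-, cs, rfl, rfl⟩ := Multiset.cons_eq_cons.1 hN
    · exact ⟨b, E, F, hB, hN', rfl⟩
    · obtain ⟨a, E', F', hA, hF', rfl⟩ := ih rfl
      exact ⟨a, E', E + F', hA, .cons hB hF', by abel⟩

theorem add_inv {M N : Multiset (FTree α)} {F : Multiset (α × α)} (h : SwF (M + N) F) :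
    ∃ F₁ F₂, SwF M F₁ ∧ SwF N F₂ ∧ F = F₁ + F₂ := by
  induction M using Multiset.induction generalizing F with
  | empty => exact ⟨0, F, .zero, by simpa using h, by simp⟩
  | cons A M ih =>
    rw [Multiset.cons_add] at h
    obtain ⟨a, E, F', hA, hF', rfl⟩ := h.cons_inv
    obtain ⟨F₁, F₂, h₁, h₂, rfl⟩ := ih hF'
    exact ⟨E + F₁, F₂, .cons hA h₁, h₂, by abel⟩

end SwF

/-- Connectedness in the graph with edges `E`. -/
def Conn (E : Multiset (ι × ι)) : ι → ι → Prop := Relation.EqvGen fun a b => (a, b) ∈ E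

namespace Conn

theorem edge {E : Multiset (ι × ι)} {a b : ι} (h : (a, b) ∈ E) : Conn E a b := .rel _ _ h

theorem mono {E F : Multiset (ι × ι)} (h : E ≤ F) {a b : ι} (hab : Conn E a b) : Conn F a b :=
  Relation.EqvGen.mono (fun _ _ h' => Multiset.mem_of_le h h') _ _ hab

theorem map (f : ι → κ) {E : Multiset (ι × ι)} {a b : ι} (h : Conn E a b) :
    Conn (E.map (Prod.map f f)) (f a) (f b) := by
  induction h with
  | rel a b h => exact edge (Multiset.mem_map_of_mem (Prod.map f f) h)
  | refl a => exact .refl _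
  | symm a b _ ih => exact .symm _ _ ih
  | trans a b c _ _ ih₁ ih₂ => exact .trans _ _ _ ih₁ ih₂

theorem of_cons_loop {E : Multiset (ι × ι)} {c a b : ι} (h : Conn ((c, c) ::ₘ E) a b) :
    Conn E a b := by
  induction h with
  | rel a b h =>
    obtain h | h := Multiset.mem_cons.1 h
    · cases h; exact .refl _
    · exact edge h
  | refl a => exact .refl _
  | symm a b _ ih => exact .symm _ _ ih
  | trans a b c _ _ ih₁ ih₂ => exact .trans _ _ _ ih₁ ih₂

/-- A vertex met by no edge is its own component. -/
theorem eq_iff_of_avoid {E : Multiset (ι × ι)} {c : ι} (hE : ∀ e ∈ E, e.1 ≠ c ∧ e.2 ≠ c) {a b : ι}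
    (h : Conn E a b) : a = c ↔ b = c := by
  induction h with
  | rel a b h => simp [hE _ h]
  | refl a => rfl
  | symm a b _ ih => exact ih.symm
  | trans a b c _ _ ih₁ ih₂ => exact ih₁.trans ih₂

open Classical in
/-- A connected graph with `n + 1` vertices has at least `n` edges. -/
theorem card_le {E : Multiset (ι × ι)} {I : Finset ι}
    (h : ∀ i ∈ I, ∀ j ∈ I, Conn E i j) : I.card ≤ Multiset.card E + 1 := by
  generalize hn : Multiset.card E = n
  induction n generalizing E I with
  | zero =>
    obtain rfl := Multiset.card_eq_zero.1 hn
    refine Finset.card_le_one.2 fun i hi j hj => ?_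
    exact ((eq_iff_of_avoid (c := i) (by simp) (h i hi j hj)).1 rfl).symm
  | succ n ih =>
    obtain ⟨⟨a, b⟩, ha⟩ := Multiset.card_pos_iff_exists_mem.1 (by omega : 0 < Multiset.card E)
    obtain ⟨E, rfl⟩ := Multiset.exists_cons_of_mem ha
    -- Contract the edge from `a` to `b`: it becomes a loop, which may be dropped, and at most one
    -- vertex of `I` is lost.
    let f : ι → ι := fun k => if k = b then a else k
    have hI : I.erase b ⊆ I.image f := fun k hk => by
      obtain ⟨hk, hkI⟩ := Finset.mem_erase.1 hk
      exact Finset.mem_image.2 ⟨k, hkI, if_neg hk⟩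
    have h₁ := Finset.card_le_card hI
    have h₂ := Finset.pred_card_le_card_erase (s := I) (a := b)
    have h₃ := ih (E := E.map (Prod.map f f)) (I := I.image f) (fun i hi j hj => by
      obtain ⟨i, hi', rfl⟩ := Finset.mem_image.1 hi
      obtain ⟨j, hj', rfl⟩ := Finset.mem_image.1 hj
      have := (h i hi' j hj').map f
      rw [Multiset.map_cons] at this
      have hfa : f a = a := by simp [f]
      have hfb : f b = a := by simp [f]
      simp only [Prod.map_apply, hfa, hfb] at this
      exact this.of_cons_loop) (by simpa using hn)
    omega

end Conn

/-- All switchings of the forest `M` become connected if the leaves are identified along `q`. -/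
def ConnM (q : α → ι) (M : Multiset (FTree α)) : Prop :=
  ∀ F, SwF M F → ∀ x ∈ leavesM M, ∀ y ∈ leavesM M, Conn (F.map (Prod.map q q)) (q x) (q y)

/-- A ⅋ contributes no contracted edge: its switching selects a root, but the edges between leaves
are those of `X` and `Y`. -/
theorem ConnM.par {q : α → ι} {X Y : FTree α} {M : Multiset (FTree α)}
    (h : ConnM q (X ::ₘ Y ::ₘ M)) : ConnM q (FTree.par X Y ::ₘ M) := by
  intro F hF x hx y hy
  obtain ⟨a, E, F, hX, hM, rfl⟩ := hF.cons_inv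
  have hm : ∀ z, z ∈ leavesM (FTree.par X Y ::ₘ M) → z ∈ leavesM (X ::ₘ Y ::ₘ M) := fun z hz => by
    simpa [leaves, or_assoc] using hz
  cases hX with
  | parLeft hA hB => rw [add_assoc]; exact h _ (.cons hA (.cons hB hM)) x (hm x hx) y (hm y hy)
  | parRight hA hB => rw [add_assoc]; exact h _ (.cons hA (.cons hB hM)) x (hm x hx) y (hm y hy)

/-- The edge contributed by the new ⊗ joins the two graphs, each connected by itself. -/
theorem ConnM.tens {q : α → ι} {X Y : FTree α} {M N : Multiset (FTree α)}
    (hX : ConnM q (X ::ₘ M)) (hY : ConnM q (Y ::ₘ N)) : ConnM q (FTree.tens X Y ::ₘ (M + N)) := by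
  intro F hF
  obtain ⟨a, E, F, hT, hMN, rfl⟩ := hF.cons_inv
  obtain ⟨F₁, F₂, hM, hN, rfl⟩ := hMN.add_inv
  cases hT with
  | @tens _ _ a b E₁ E₂ hA hB =>
    have h₁ := hX _ (.cons hA hM)
    have h₂ := hY _ (.cons hB hN)
    set F := ((a, b) ::ₘ (E₁ + E₂) + (F₁ + F₂)).map (Prod.map q q) with hF
    have l₁ : (E₁ + F₁).map (Prod.map q q) ≤ F := by
      refine Multiset.map_le_map (Multiset.le_iff_exists_add.2 ⟨(a, b) ::ₘ (E₂ + F₂), ?_⟩)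
      simp only [← Multiset.singleton_add]; abel
    have l₂ : (E₂ + F₂).map (Prod.map q q) ≤ F := by
      refine Multiset.map_le_map (Multiset.le_iff_exists_add.2 ⟨(a, b) ::ₘ (E₁ + F₁), ?_⟩)
      simp only [← Multiset.singleton_add]; abel
    have hab : Conn F (q a) (q b) := Conn.edge (by simp [hF])
    have ha : a ∈ leavesM (X ::ₘ M) := by simp [hA.mem_leaves]
    have hb : b ∈ leavesM (Y ::ₘ N) := by simp [hB.mem_leaves]
    have key : ∀ x ∈ leavesM (FTree.tens X Y ::ₘ (M + N)), Conn F (q a) (q x) := by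
      intro x hx
      have hx : x ∈ leavesM (X ::ₘ M) ∨ x ∈ leavesM (Y ::ₘ N) := by
        simp only [leavesM_cons, leavesM_add, Multiset.mem_add, leaves, Multiset.mem_coe,
          List.mem_append] at hx ⊢
        tauto
      obtain hx | hx := hx
      · exact (h₁ a ha x hx).mono l₁
      · exact hab.trans _ _ _ ((h₂ b hb x hx).mono l₂)
    exact fun x hx y hy => ((key x hx).symm _ _).trans _ _ _ (key y hy)

/-- The cuts of a net, seen as `⊗`-trees. -/
def cutTrees (K : Cuts α) : Multiset (FTree α) := K.map fun c => tens c.1 c.2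

theorem Seq.connM {lab : α → Atom} {link : α → α} {q : α → ι} (hq : ∀ v, q (link v) = q v)
    {G : Multiset (FTree α)} {K : Cuts α} (h : Seq lab link G K) : ConnM q (G + cutTrees K) := by
  induction h with
  | ax v =>
    have : ∀ x ∈ leavesM ({FTree.leaf (link v), FTree.leaf v} + cutTrees (0 : Cuts α)),
        q x = q v := fun x hx => by
      have : x = link v ∨ x = v := by
        simpa [cutTrees, leaves] using hx
      obtain rfl | rfl := this
      · exact hq v
      · rfl
    intro F _ x hx y hy
    rw [this x hx, this y hy]
    exact .refl _
  | par _ ih => simpa using ConnM.par (by simpa using ih)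
  | @tens X Y G₁ G₂ K₁ K₂ _ _ ih₁ ih₂ =>
    rw [Multiset.cons_add] at ih₁ ih₂
    convert ih₁.tens ih₂ using 1
    simp only [cutTrees, Multiset.map_add, ← Multiset.singleton_add]; abel
  -- The new cut is the tree `X ⊗ Y` in `cutTrees`, so this is the ⊗ case again.
  | @cut X Y G₁ G₂ K₁ K₂ _ _ _ ih₁ ih₂ =>
    rw [Multiset.cons_add] at ih₁ ih₂
    convert ih₁.tens ih₂ using 1
    simp only [cutTrees, Multiset.map_add, Multiset.map_singleton,
      ← Multiset.singleton_add]
    abel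

/-- An axiom has two leaves and no ⊗. A ⅋ changes neither number; a ⊗ or a cut adds up the leaves of
two sequents and adds one ⊗, which absorbs the extra 2. -/
theorem Seq.card_leaves {lab : α → Atom} {link : α → α}
    {G : Multiset (FTree α)} {K : Cuts α} (h : Seq lab link G K) :
    2 * tensCountM (G + cutTrees K) + 2 = Multiset.card (leavesM (G + cutTrees K)) := by
  induction h with
  | ax v => simp [cutTrees, tensCountM, leavesM, leaves, tensCount]
  | par _ ih =>
    simp [leaves, tensCount] at ih ⊢
    omega
  | @tens X Y G₁ G₂ K₁ K₂ _ _ ih₁ ih₂ =>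
    simp [leaves, tensCount, cutTrees] at ih₁ ih₂ ⊢
    omega
  | @cut X Y G₁ G₂ K₁ K₂ _ _ _ ih₁ ih₂ =>
    simp [leaves, tensCount, cutTrees] at ih₁ ih₂ ⊢
    omega

end Switchings

/-! ### Sequentialization by contracting redexes. -/

section Contraction

variable {α ι κ V : Type*}

/-- Every switching of `T` is matched by one of `U`, up to `g` and the additional edges `D`. -/
def Sim (g : α → κ) (D : Multiset (κ × κ)) (T U : FTree α) : Prop :=
  ∀ r E, Sw T r E → ∃ r' E', Sw U r' E' ∧ g r' = g r ∧
    E'.map (Prod.map g g) = D + E.map (Prod.map g g)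

/-- A context sees a tree only through its root leaf and its edges. The condition `g r' = g r`
ensures that an enclosing ⊗ gives the same edge after applying `g`. -/
theorem Sim.fill {g : α → κ} {D : Multiset (κ × κ)} {T U : FTree α} (h : Sim g D T U)
    (S : Ctx α) : Sim g D (S.fill T) (S.fill U) := by
  induction S with
  | hole => exact h
  | tensLeft S B ih =>
    intro r E hE
    cases hE with
    | @tens _ _ a b E F hA hB =>
      obtain ⟨r', E', hE', hr, he⟩ := ih _ _ hA
      refine ⟨_, _, .tens hE' hB, hr, ?_⟩
      simp only [Multiset.map_cons, Multiset.map_add, he, Prod.map_apply, hr]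
      simp only [← Multiset.singleton_add]
      abel
  | tensRight B S ih =>
    intro r E hE
    cases hE with
    | @tens _ _ a b E F hB hA =>
      obtain ⟨r', E', hE', hr, he⟩ := ih _ _ hA
      refine ⟨_, _, .tens hB hE', rfl, ?_⟩
      simp only [Multiset.map_cons, Multiset.map_add, he, Prod.map_apply, hr]
      simp only [← Multiset.singleton_add]
      abel
  | parLeft S B ih =>
    intro r E hE
    cases hE with
    | parLeft hA hB =>
      obtain ⟨r', E', hE', hr, he⟩ := ih _ _ hA
      exact ⟨_, _, .parLeft hE' hB, hr, by rw [Multiset.map_add, Multiset.map_add, he, add_assoc]⟩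
    | parRight hA hB =>
      obtain ⟨r', E', hE', hr, he⟩ := ih _ _ hA
      exact ⟨_, _, .parRight hE' hB, rfl,
        by rw [Multiset.map_add, Multiset.map_add, he, add_assoc]⟩
  | parRight B S ih =>
    intro r E hE
    cases hE with
    | parLeft hB hA =>
      obtain ⟨r', E', hE', hr, he⟩ := ih _ _ hA
      exact ⟨_, _, .parLeft hB hE', rfl,
        by rw [Multiset.map_add, Multiset.map_add, he, add_left_comm]⟩
    | parRight hB hA =>
      obtain ⟨r', E', hE', hr, he⟩ := ih _ _ hA
      exact ⟨_, _, .parRight hB hE', hr,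
        by rw [Multiset.map_add, Multiset.map_add, he, add_left_comm]⟩

theorem Sim.cons {g : α → κ} {D : Multiset (κ × κ)} {T U : FTree α} (h : Sim g D T U)
    {M : Multiset (FTree α)} {F : Multiset (α × α)} (hF : SwF (T ::ₘ M) F) :
    ∃ F', SwF (U ::ₘ M) F' ∧ F'.map (Prod.map g g) = D + F.map (Prod.map g g) := by
  obtain ⟨a, E, F, hT, hM, rfl⟩ := hF.cons_inv
  obtain ⟨r', E', hE', -, he⟩ := h _ _ hT
  exact ⟨_, .cons hE' hM, by rw [Multiset.map_add, Multiset.map_add, he, add_assoc]⟩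

theorem Ctx.exists_leaves (S : Ctx α) :
    ∃ L : Multiset α, ∀ T, ((S.fill T).leaves : Multiset α) = T.leaves + L := by
  induction S with
  | hole => exact ⟨0, by simp [Ctx.fill]⟩
  | tensLeft S B ih =>
    obtain ⟨L, h⟩ := ih
    exact ⟨L + B.leaves, fun T => by rw [Ctx.fill, leaves, ← Multiset.coe_add, h, add_assoc]⟩
  | tensRight B S ih =>
    obtain ⟨L, h⟩ := ih
    exact ⟨L + B.leaves, fun T => by rw [Ctx.fill, leaves, ← Multiset.coe_add, h]; abel⟩
  | parLeft S B ih =>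
    obtain ⟨L, h⟩ := ih
    exact ⟨L + B.leaves, fun T => by rw [Ctx.fill, leaves, ← Multiset.coe_add, h, add_assoc]⟩
  | parRight B S ih =>
    obtain ⟨L, h⟩ := ih
    exact ⟨L + B.leaves, fun T => by rw [Ctx.fill, leaves, ← Multiset.coe_add, h]; abel⟩

theorem Ctx.exists_tensCount (S : Ctx α) :
    ∃ n, ∀ T, (S.fill T).tensCount = T.tensCount + n := by
  induction S with
  | hole => exact ⟨0, fun _ => rfl⟩
  | tensLeft S B ih | tensRight B S ih =>
    obtain ⟨n, h⟩ := ih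
    exact ⟨n + B.tensCount + 1, fun T => by rw [Ctx.fill, tensCount, h]; omega⟩
  | parLeft S B ih | parRight B S ih =>
    obtain ⟨n, h⟩ := ih
    exact ⟨n + B.tensCount, fun T => by rw [Ctx.fill, tensCount, h]; omega⟩

theorem Ctx.exists_innerCount (S : Ctx α) :
    ∃ n, ∀ T, (S.fill T).innerCount = T.innerCount + n := by
  induction S with
  | hole => exact ⟨0, fun _ => rfl⟩
  | tensLeft S B ih | tensRight B S ih | parLeft S B ih | parRight B S ih =>
    obtain ⟨n, h⟩ := ih
    exact ⟨n + B.innerCount + 1, fun T => by rw [Ctx.fill, innerCount, h]; omega⟩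

/-- No `⊗` has two leaves as children, and no `⅋` has two leaves of the same block as children. -/
def NoRedex (q : α → ι) : FTree α → Prop
  | leaf _ => True
  | tens A B => ¬(∃ x y, A = leaf x ∧ B = leaf y) ∧ NoRedex q A ∧ NoRedex q B
  | par A B => ¬(∃ x y, A = leaf x ∧ B = leaf y ∧ q x = q y) ∧ NoRedex q A ∧ NoRedex q B

theorem exists_redex {q : α → ι} {T : FTree α} (h : ¬ NoRedex q T) :
    ∃ (S : Ctx α) (x y : α), T = S.fill (.tens (leaf x) (leaf y)) ∨
      (q x = q y ∧ T = S.fill (.par (leaf x) (leaf y))) := by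
  induction T with
  | leaf a => exact absurd trivial h
  | tens A B ihA ihB =>
    by_cases hA : NoRedex q A
    · by_cases hB : NoRedex q B
      · have : ∃ x y, A = leaf x ∧ B = leaf y := by
          by_contra hc
          exact h ⟨hc, hA, hB⟩
        obtain ⟨x, y, rfl, rfl⟩ := this
        exact ⟨.hole, x, y, .inl rfl⟩
      · obtain ⟨S, x, y, h⟩ := ihB hB
        exact ⟨.tensRight A S, x, y, h.imp (congrArg _) (And.imp_right (congrArg _))⟩
    · obtain ⟨S, x, y, h⟩ := ihA hA
      exact ⟨.tensLeft S B, x, y, h.imp (congrArg (tens · B)) (And.imp_right (congrArg (tens · B)))⟩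
  | par A B ihA ihB =>
    by_cases hA : NoRedex q A
    · by_cases hB : NoRedex q B
      · have : ∃ x y, A = leaf x ∧ B = leaf y ∧ q x = q y := by
          by_contra hc
          exact h ⟨hc, hA, hB⟩
        obtain ⟨x, y, rfl, rfl, hxy⟩ := this
        exact ⟨.hole, x, y, .inr ⟨hxy, rfl⟩⟩
      · obtain ⟨S, x, y, h⟩ := ihB hB
        exact ⟨.parRight A S, x, y, h.imp (congrArg _) (And.imp_right (congrArg _))⟩
    · obtain ⟨S, x, y, h⟩ := ihA hA
      exact ⟨.parLeft S B, x, y, h.imp (congrArg (par · B)) (And.imp_right (congrArg (par · B)))⟩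

/-- The leaf of a tree which is a leaf. -/
def FTree.asLeaf : FTree α → List α
  | leaf a => [a]
  | _ => []

/-- The leaves which are children of `⊗`-nodes. -/
def FTree.tensLeaves : FTree α → List α
  | leaf _ => []
  | tens A B => asLeaf A ++ asLeaf B ++ (tensLeaves A ++ tensLeaves B)
  | par A B => tensLeaves A ++ tensLeaves B

/-- Without redexes every ⊗ has at most one leaf among its two children. -/
theorem NoRedex.length_tensLeaves_le {q : α → ι} {T : FTree α} (h : NoRedex q T) :
    T.tensLeaves.length ≤ T.tensCount := by
  induction T with
  | leaf a => simp [tensLeaves]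
  | tens A B ihA ihB =>
    have h₁ := ihA h.2.1
    have h₂ := ihB h.2.2
    have : A.asLeaf.length + B.asLeaf.length ≤ 1 := by
      cases A <;> cases B <;> simp [asLeaf]
      exact h.1 ⟨_, _, rfl, rfl⟩
    simp only [tensLeaves, tensCount, List.length_append]
    omega
  | par A B ihA ihB =>
    have h₁ := ihA h.2.1
    have h₂ := ihB h.2.2
    simp only [tensLeaves, tensCount, List.length_append]
    omega

/-- A block which is not touched by any `⊗` is isolated in some switching. -/
theorem NoRedex.exists_avoid {q : α → ι} {T : FTree α} (h : NoRedex q T) {b : ι}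
    (hb : ∀ x ∈ T.tensLeaves, q x ≠ b) :
    ∃ r E, Sw T r E ∧ (q r = b → T = leaf r) ∧ ∀ e ∈ E, q e.1 ≠ b ∧ q e.2 ≠ b := by
  induction T with
  | leaf a => exact ⟨a, 0, .leaf a, fun _ => rfl, by simp⟩
  | tens A B ihA ihB =>
    simp only [tensLeaves, List.mem_append] at hb
    obtain ⟨r, E, hA, hr, hE⟩ := ihA h.2.1 fun x hx => hb x (by simp [hx])
    obtain ⟨s, F, hB, hs, hF⟩ := ihB h.2.2 fun x hx => hb x (by simp [hx])
    -- If the root leaf of `A` lay in block `b`, then `A` would be that leaf, a child of a ⊗,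
    -- contrary to `hb`.
    have hr' : q r ≠ b := fun h => hb r (by rw [hr h]; simp [asLeaf]) h
    have hs' : q s ≠ b := fun h => hb s (by rw [hs h]; simp [asLeaf]) h
    refine ⟨_, _, .tens hA hB, fun h => absurd h hr', fun e he => ?_⟩
    simp only [Multiset.mem_cons, Multiset.mem_add] at he
    obtain rfl | he | he := he
    · exact ⟨hr', hs'⟩
    · exact hE e he
    · exact hF e he
  | par A B ihA ihB =>
    simp only [tensLeaves, List.mem_append] at hb
    obtain ⟨r, E, hA, hr, hE⟩ := ihA h.2.1 fun x hx => hb x (by simp [hx])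
    obtain ⟨s, F, hB, hs, hF⟩ := ihB h.2.2 fun x hx => hb x (by simp [hx])
    have hEF : ∀ e ∈ E + F, q e.1 ≠ b ∧ q e.2 ≠ b := fun e he =>
      (Multiset.mem_add.1 he).elim (hE e) (hF e)
    -- Keep the edge to the side whose root leaf is outside `b`. If both were inside, both children
    -- would be leaves of one block, a redex.
    by_cases hr' : q r = b
    · have hs' : q s ≠ b := fun hs' => h.1 ⟨r, s, hr hr', hs hs', hr'.trans hs'.symm⟩
      exact ⟨_, _, .parRight hA hB, fun h => absurd h hs', hEF⟩
    · exact ⟨_, _, .parLeft hA hB, fun h => absurd h hr', hEF⟩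

/-- With no ⊗ and only one block, an innermost ⅋ would be a redex. -/
theorem NoRedex.eq_leaf {q : α → ι} {T : FTree α} (h : NoRedex q T) (ht : T.tensCount = 0) {b : ι}
    (hb : ∀ x ∈ T.leaves, q x = b) : ∃ x, T = leaf x := by
  induction T with
  | leaf a => exact ⟨a, rfl⟩
  | tens A B ihA ihB => simp [tensCount] at ht
  | par A B ihA ihB =>
    simp only [tensCount, Nat.add_eq_zero_iff] at ht
    simp only [leaves, List.mem_append] at hb
    obtain ⟨x, rfl⟩ := ihA h.2.1 ht.1 fun x hx => hb x (.inl hx)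
    obtain ⟨y, rfl⟩ := ihB h.2.2 ht.2 fun x hx => hb x (.inr hx)
    exact absurd ⟨x, y, rfl, rfl, (hb x (by simp [leaves])).trans (hb y (by simp [leaves])).symm⟩ h.1

open Classical in
/-- The blocks which occur in a forest. -/
noncomputable def blocks (q : α → ι) (M : Multiset (FTree α)) : Finset ι := ((leavesM M).map q).toFinset

theorem mem_blocks {q : α → ι} {M : Multiset (FTree α)} {i : ι} :
    i ∈ blocks q M ↔ ∃ x ∈ leavesM M, q x = i := by
  simp [blocks]

open Classical in
/-- The elements of block `i`. -/
noncomputable def blockPart (q : α → ι) (i : ι) (L : Multiset α) : Multiset α :=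
  L.filter fun x => q x = i

open Classical in
theorem blockPart_cons_of_eq {q : α → ι} {i : ι} {x : α} (h : q x = i) (L : Multiset α) :
    blockPart q i (x ::ₘ L) = x ::ₘ blockPart q i L := Multiset.filter_cons_of_pos _ h

open Classical in
theorem blockPart_cons_of_ne {q : α → ι} {i : ι} {x : α} (h : q x ≠ i) (L : Multiset α) :
    blockPart q i (x ::ₘ L) = blockPart q i L := Multiset.filter_cons_of_neg _ h

open Classical in
/-- A correct forest without redexes consists of leaves of one block. -/
theorem eq_leaves_of_noRedex {q : α → ι} {M : Multiset (FTree α)} (h : ∀ T ∈ M, NoRedex q T)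
    (hc : ConnM q M) (hn : tensCountM M + 1 = (blocks q M).card) :
    ∃ b, (∀ x ∈ leavesM M, q x = b) ∧ M = (leavesM M).map leaf := by
  -- Pigeonhole: the number of leaves directly below tensors is at most the number of tensors, which
  -- is less than the number of blocks.
  obtain ⟨b, hb, htl⟩ : ∃ b ∈ blocks q M, ∀ T ∈ M, ∀ x ∈ T.tensLeaves, q x ≠ b := by
    have hle : Multiset.card (M.bind fun T => (T.tensLeaves : Multiset α)) ≤ tensCountM M := by
      rw [Multiset.card_bind, tensCountM]
      exact Multiset.sum_map_le_sum_map _ _ fun T hT => (h T hT).length_tensLeaves_le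
    have hlt : (((M.bind fun T => (T.tensLeaves : Multiset α)).map q).toFinset).card <
        (blocks q M).card := by
      have := Multiset.toFinset_card_le ((M.bind fun T => (T.tensLeaves : Multiset α)).map q)
      rw [Multiset.card_map] at this
      omega
    obtain ⟨b, hb, hb'⟩ := Finset.exists_mem_notMem_of_card_lt_card hlt
    refine ⟨b, hb, fun T hT x hx hxb => hb' ?_⟩
    rw [Multiset.mem_toFinset, Multiset.mem_map]
    exact ⟨x, Multiset.mem_bind.2 ⟨T, hT, hx⟩, hxb⟩
  -- The switchings of the individual trees combine to one in which `b` is isolated; connectedness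
  -- then makes `b` the only block.
  obtain ⟨F, hF, hFb⟩ : ∃ F, SwF M F ∧ ∀ e ∈ F, q e.1 ≠ b ∧ q e.2 ≠ b := by
    clear hc hn hb
    induction M using Multiset.induction with
    | empty => exact ⟨0, .zero, by simp⟩
    | cons T M ih =>
      obtain ⟨F, hF, hFb⟩ := ih (fun T hT => h T (Multiset.mem_cons_of_mem hT))
        (fun T hT => htl T (Multiset.mem_cons_of_mem hT))
      obtain ⟨r, E, hE, -, hEb⟩ := (h T (Multiset.mem_cons_self _ _)).exists_avoid
        (htl T (Multiset.mem_cons_self _ _))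
      exact ⟨_, .cons hE hF, fun e he => (Multiset.mem_add.1 he).elim (hEb e) (hFb e)⟩
  obtain ⟨x₀, hx₀, rfl⟩ := mem_blocks.1 hb
  have hall : ∀ x ∈ leavesM M, q x = q x₀ := fun x hx => by
    refine (Conn.eq_iff_of_avoid (c := q x₀) ?_ (hc F hF x₀ hx₀ x hx)).1 rfl
    intro e he
    obtain ⟨e, he', rfl⟩ := Multiset.mem_map.1 he
    exact hFb e he'
  -- One block forces zero tensors, by the count `hn`.
  have h0 : tensCountM M = 0 := by
    have : (blocks q M).card ≤ 1 := Finset.card_le_one.2 fun i hi j hj => by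
      obtain ⟨x, hx, rfl⟩ := mem_blocks.1 hi
      obtain ⟨y, hy, rfl⟩ := mem_blocks.1 hj
      rw [hall x hx, hall y hy]
    omega
  refine ⟨q x₀, hall, ?_⟩
  have hleaf : ∀ T ∈ M, ∃ x, T = leaf x := fun T hT =>
    (h T hT).eq_leaf (Multiset.sum_eq_zero_iff.1 h0 _ (Multiset.mem_map_of_mem _ hT))
      fun x hx => hall x (Multiset.mem_bind.2 ⟨T, hT, hx⟩)
  clear * - hleaf
  induction M using Multiset.induction with
  | empty => rfl
  | cons T M ih =>
    obtain ⟨x, rfl⟩ := hleaf T (Multiset.mem_cons_self _ _)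
    simpa [leaves] using ih fun T hT => hleaf T (Multiset.mem_cons_of_mem hT)

/-- Flattening a tree of trees. -/
def FTree.join : FTree (FTree V) → FTree V
  | leaf X => X
  | tens A B => tens (join A) (join B)
  | par A B => par (join A) (join B)

theorem join_fill_congr (S : Ctx (FTree V)) {T U : FTree (FTree V)} (h : T.join = U.join) :
    (S.fill T).join = (S.fill U).join := by
  induction S <;> simp_all [Ctx.fill, join]

/-- The leftmost leaf. -/
def FTree.head : FTree V → V
  | leaf a => a
  | tens A _ => head A
  | par A _ => head A

open Classical in
/-- Sequentialization by contraction: a correct forest whose leaves are named formulas, grouped into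
blocks which are provable sequents, is provable. -/
theorem Seq.of_connM {lab : V → Atom} {link : V → V} (n : ℕ) (M : Multiset (FTree (FTree V)))
    (p : V → ι) (hM : innerCountM M = n) (hc : ConnM (p ∘ head) M)
    (hn : tensCountM M + 1 = (blocks (p ∘ head) M).card)
    (hp : ∀ i ∈ blocks (p ∘ head) M,
      Seq lab link (blockPart (p ∘ head) i (leavesM M)) 0) :
    Seq lab link (M.map join) 0 := by
  -- Each contraction replaces an inner node with two leaves by a single leaf, so the number of
  -- inner nodes drops.
  induction n using Nat.strong_induction_on generalizing M p with
  | _ n ih =>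
  by_cases hr : ∀ T ∈ M, NoRedex (p ∘ head) T
  · obtain ⟨b, hb, hM'⟩ := eq_leaves_of_noRedex hr hc hn
    have hb' : b ∈ blocks (p ∘ head) M := by
      obtain ⟨i, hi⟩ := Finset.card_pos.1 (by omega : 0 < (blocks (p ∘ head) M).card)
      obtain ⟨x, hx, rfl⟩ := mem_blocks.1 hi
      rw [hb x hx] at hi
      exact hi
    have h := hp b hb'
    rw [blockPart, Multiset.filter_eq_self.2 hb] at h
    rw [hM', Multiset.map_map]
    exact h.congr ((Multiset.map_congr rfl fun X _ => rfl).trans (Multiset.map_id _)) rfl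
  push Not at hr
  obtain ⟨T, hT, hr⟩ := hr
  obtain ⟨N, rfl⟩ := Multiset.exists_cons_of_mem hT
  obtain ⟨S, X, Y, h⟩ := exists_redex hr
  obtain ⟨L, hL⟩ := S.exists_leaves
  obtain ⟨t, ht⟩ := S.exists_tensCount
  obtain ⟨m, hm⟩ := S.exists_innerCount
  obtain rfl | ⟨hXY, rfl⟩ := h
  · set q := p ∘ head with hq
    have hl : leavesM (S.fill (.tens (leaf X) (leaf Y)) ::ₘ N) = X ::ₘ Y ::ₘ (L + leavesM N) := by
      rw [leavesM_cons, hL, leaves, leaves, leaves, ← Multiset.coe_add]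
      simp
    have hl' : leavesM (S.fill (leaf (.tens X Y)) ::ₘ N) = .tens X Y ::ₘ (L + leavesM N) := by
      rw [leavesM_cons, hL]; simp [leaves]
    set R := L + leavesM N
    have hsim : Sim q {(q X, q Y)} (leaf (.tens X Y)) (.tens (leaf X) (leaf Y)) := by
      intro r E hE
      cases hE
      exact ⟨_, _, .tens (.leaf X) (.leaf Y), rfl, rfl⟩
    -- If `X` and `Y` shared a block, this ⊗ would be a loop in the contracted graph; the other
    -- tensors would then connect all blocks, although there are two fewer of them than blocks.
    have hne : q X ≠ q Y := by
      intro hXY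
      obtain ⟨F, hF⟩ := SwF.exists_of (S.fill (leaf (.tens X Y)) ::ₘ N)
      obtain ⟨F', hF', he⟩ := (hsim.fill S).cons hF
      have := Conn.card_le (E := F.map (Prod.map q q)) (I := blocks q _) fun i hi j hj => by
        obtain ⟨x, hx, rfl⟩ := mem_blocks.1 hi
        obtain ⟨y, hy, rfl⟩ := mem_blocks.1 hj
        have := hc F' hF' x hx y hy
        rw [he, hXY, Multiset.singleton_add] at this
        exact this.of_cons_loop
      rw [Multiset.card_map, hF.card_eq, ← hn, tensCountM_cons, tensCountM_cons, ht, ht] at this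
      simp [tensCount] at this
    -- Merge the block of `Y` into that of `X`.
    let f : ι → ι := fun k => if k = q Y then q X else k
    have hfX : f (q X) = q X := by simp [f]
    have hfY : f (q Y) = q X := by simp [f]
    have hsim' : Sim (f ∘ q) {(q X, q X)} (leaf (.tens X Y)) (.tens (leaf X) (leaf Y)) := by
      intro r E hE
      cases hE
      exact ⟨_, _, .tens (.leaf X) (.leaf Y), rfl, by simp [hfX, hfY]⟩
    -- A formula takes its block from its leftmost leaf, so the new leaf falls into the block of `X`
    -- with no change to the naming.
    have hz : q (.tens X Y) = q X := rfl
    have hbl : blocks (f ∘ q) (S.fill (leaf (.tens X Y)) ::ₘ N) =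
        (blocks q (S.fill (.tens (leaf X) (leaf Y)) ::ₘ N)).erase (q Y) := by
      ext i
      rw [Finset.mem_erase, mem_blocks, mem_blocks, hl, hl']
      constructor
      · rintro ⟨x, hx, rfl⟩
        simp only [Function.comp, f]
        split_ifs with h
        · exact ⟨hne, X, by simp, rfl⟩
        · refine ⟨h, ?_⟩
          obtain rfl | hx := Multiset.mem_cons.1 hx
          · exact ⟨X, by simp, rfl⟩
          · exact ⟨x, by simp [hx], rfl⟩
      · rintro ⟨hi, x, hx, rfl⟩
        obtain rfl | hx := Multiset.mem_cons.1 hx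
        · exact ⟨.tens x Y, by simp, hfX⟩
        obtain rfl | hx := Multiset.mem_cons.1 hx
        · exact absurd rfl hi
        · exact ⟨x, by simp [hx], by simp [f, hi]⟩
    have hYm : q Y ∈ blocks q (S.fill (.tens (leaf X) (leaf Y)) ::ₘ N) :=
      mem_blocks.2 ⟨Y, by simp [hl], rfl⟩
    have hXm : q X ∈ blocks q (S.fill (.tens (leaf X) (leaf Y)) ::ₘ N) :=
      mem_blocks.2 ⟨X, by simp [hl], rfl⟩
    refine (ih _ ?_ (S.fill (leaf (.tens X Y)) ::ₘ N) (f ∘ p) rfl ?_ ?_ ?_).congr ?_ rfl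
    · rw [← hM, innerCountM_cons, innerCountM_cons, hm, hm]
      simp [innerCount]
    · change ConnM (f ∘ q) _
      intro F hF
      obtain ⟨F', hF', he⟩ := (hsim'.fill S).cons hF
      have key : ∀ x ∈ leavesM (S.fill (.tens (leaf X) (leaf Y)) ::ₘ N),
          ∀ y ∈ leavesM (S.fill (.tens (leaf X) (leaf Y)) ::ₘ N),
          Conn (F.map (Prod.map (f ∘ q) (f ∘ q))) ((f ∘ q) x) ((f ∘ q) y) := by
        intro x hx y hy
        have := (hc F' hF' x hx y hy).map f
        rw [Multiset.map_map, Prod.map_comp_map, he, Multiset.singleton_add] at this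
        exact this.of_cons_loop
      have hrep : ∀ x ∈ leavesM (S.fill (leaf (.tens X Y)) ::ₘ N),
          ∃ y ∈ leavesM (S.fill (.tens (leaf X) (leaf Y)) ::ₘ N), q y = q x := by
        intro x hx
        rw [hl'] at hx
        rw [hl]
        obtain rfl | hx := Multiset.mem_cons.1 hx
        · exact ⟨X, by simp, rfl⟩
        · exact ⟨x, by simp [hx], rfl⟩
      intro x hx y hy
      obtain ⟨x', hx', hxe⟩ := hrep x hx
      obtain ⟨y', hy', hye⟩ := hrep y hy
      have := key x' hx' y' hy'
      simp only [Function.comp_apply, hxe, hye] at this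
      exact this
    · change _ = (blocks (f ∘ q) _).card
      rw [hbl, Finset.card_erase_of_mem hYm, ← hn, tensCountM_cons, tensCountM_cons, ht, ht]
      simp [tensCount]; omega
    · change ∀ i ∈ blocks (f ∘ q) _, Seq lab link (blockPart (f ∘ q) i _) 0
      intro i hi
      rw [hbl, Finset.mem_erase] at hi
      rw [hl']
      by_cases hiX : i = q X
      · subst hiX
        have h₁ := hp _ hXm
        have h₂ := hp _ hYm
        rw [hl, blockPart_cons_of_eq rfl, blockPart_cons_of_ne hne.symm] at h₁
        rw [hl, blockPart_cons_of_ne hne, blockPart_cons_of_eq rfl] at h₂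
        -- The merged block is proved by the ⊗-rule from the two old blocks; what remains is that
        -- its other elements are those of both blocks, which are disjoint.
        refine (h₁.tens h₂).congr ?_ rfl
        rw [blockPart_cons_of_eq (show (f ∘ q) (.tens X Y) = q X from hfX), blockPart, blockPart, blockPart, Multiset.filter_add_filter]
        have e₁ : R.filter (fun Z => q Z = q X ∧ q Z = q Y) = 0 :=
          Multiset.filter_eq_nil.2 fun Z _ h => hne (h.1.symm.trans h.2)
        rw [e₁, add_zero]
        congr 1
        refine Multiset.filter_congr fun Z _ => ?_
        simp only [f, Function.comp_apply]
        split_ifs with h <;> simp [h]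
      · have h₁ := hp i hi.2
        rw [hl, blockPart_cons_of_ne (Ne.symm hiX), blockPart_cons_of_ne (Ne.symm hi.1)] at h₁
        rw [blockPart_cons_of_ne (by rw [Function.comp_apply, hz, hfX]; exact Ne.symm hiX)]
        refine h₁.congr (Multiset.filter_congr fun Z _ => ?_) rfl
        simp only [f, Function.comp_apply]
        split_ifs with h
        · simp [h, Ne.symm hiX, Ne.symm hi.1]
        · rfl
    · rw [Multiset.map_cons, Multiset.map_cons]
      exact congrArg (· ::ₘ _) (join_fill_congr S rfl)
  · set q := p ∘ head with hq
    have hl : leavesM (S.fill (.par (leaf X) (leaf Y)) ::ₘ N) = X ::ₘ Y ::ₘ (L + leavesM N) := by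
      rw [leavesM_cons, hL, leaves, leaves, leaves, ← Multiset.coe_add]
      simp
    have hl' : leavesM (S.fill (leaf (.par X Y)) ::ₘ N) = .par X Y ::ₘ (L + leavesM N) := by
      rw [leavesM_cons, hL]; simp [leaves]
    set R := L + leavesM N
    have hz : q (.par X Y) = q X := rfl
    -- Contracting a ⅋ inside one block changes neither the set of blocks nor the edges between
    -- them, so no merging is needed.
    have hsim : Sim q 0 (leaf (.par X Y)) (.par (leaf X) (leaf Y)) := by
      intro r E hE
      cases hE
      exact ⟨_, _, .parLeft (.leaf X) (.leaf Y), rfl, rfl⟩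
    have hbl : blocks q (S.fill (leaf (.par X Y)) ::ₘ N) =
        blocks q (S.fill (.par (leaf X) (leaf Y)) ::ₘ N) := by
      ext i
      rw [mem_blocks, mem_blocks, hl, hl']
      simp only [Multiset.mem_cons, exists_eq_or_imp, hz, ← hXY]
      tauto
    refine (ih _ ?_ (S.fill (leaf (.par X Y)) ::ₘ N) p rfl ?_ ?_ ?_).congr ?_ rfl
    · rw [← hM, innerCountM_cons, innerCountM_cons, hm, hm]
      simp [innerCount]
    · intro F hF
      obtain ⟨F', hF', he⟩ := (hsim.fill S).cons hF
      rw [zero_add] at he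
      have hrep : ∀ x ∈ leavesM (S.fill (leaf (.par X Y)) ::ₘ N),
          ∃ y ∈ leavesM (S.fill (.par (leaf X) (leaf Y)) ::ₘ N), q y = q x := by
        intro x hx
        rw [hl'] at hx
        rw [hl]
        obtain rfl | hx := Multiset.mem_cons.1 hx
        · exact ⟨X, by simp, rfl⟩
        · exact ⟨x, by simp [hx], rfl⟩
      intro x hx y hy
      obtain ⟨x', hx', hxe⟩ := hrep x hx
      obtain ⟨y', hy', hye⟩ := hrep y hy
      have := hc F' hF' x' hx' y' hy'
      rw [hxe, hye, he] at this
      exact this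
    · rw [hbl, ← hn, tensCountM_cons, tensCountM_cons, ht, ht]
      simp [tensCount]
    · intro i hi
      rw [hbl] at hi
      have h₁ := hp i hi
      rw [hl] at h₁
      rw [hl']
      by_cases hiX : q X = i
      · rw [blockPart_cons_of_eq hiX, blockPart_cons_of_eq (hXY.symm.trans hiX)] at h₁
        rw [blockPart_cons_of_eq (hz.trans hiX)]
        exact h₁.par
      · rw [blockPart_cons_of_ne hiX, blockPart_cons_of_ne fun h => hiX (hXY.trans h)] at h₁
        rw [blockPart_cons_of_ne fun h => hiX (hz.symm.trans h)]
        exact h₁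
    · rw [Multiset.map_cons, Multiset.map_cons]
      exact congrArg (· ::ₘ _) (join_fill_congr S rfl)

end Contraction

/-! ### Subtrees of a forest and switchings given by functions. -/

section Subtrees

variable {V : Type*}

/-- The list of subtrees. -/
def FTree.subs : FTree V → List (FTree V)
  | leaf a => [leaf a]
  | tens A B => tens A B :: (subs A ++ subs B)
  | par A B => par A B :: (subs A ++ subs B)

theorem mem_subs {A F : FTree V} : A ∈ F.subs ↔ A.IsSub F := by
  induction F <;> simp_all [subs, IsSub]

theorem self_mem_subs (F : FTree V) : F ∈ F.subs := by cases F <;> simp [subs]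

theorem head_mem_leaves (T : FTree V) : T.head ∈ T.leaves := by
  induction T <;> simp_all [head, leaves]

theorem sublist_leaves_of_mem_subs {A F : FTree V} (h : A ∈ F.subs) :
    A.leaves.Sublist F.leaves := by
  induction F with
  | leaf a => rw [List.mem_singleton.1 h]
  | tens B C ihB ihC | par B C ihB ihC =>
    simp only [subs, List.mem_cons, List.mem_append] at h
    obtain rfl | h | h := h
    · exact .refl _
    · exact (ihB h).trans (List.sublist_append_left _ _)
    · exact (ihC h).trans (List.sublist_append_right _ _)

theorem innerCount_le_of_mem_subs {A F : FTree V} (h : A ∈ F.subs) :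
    A.innerCount ≤ F.innerCount := by
  induction F with
  | leaf a => rw [List.mem_singleton.1 h]
  | tens B C ihB ihC | par B C ihB ihC =>
    simp only [subs, List.mem_cons, List.mem_append] at h
    obtain rfl | h | h := h
    · exact le_rfl
    · have := ihB h; simp only [innerCount]; omega
    · have := ihC h; simp only [innerCount]; omega

theorem leaf_mem_subs {v : V} {F : FTree V} : leaf v ∈ F.subs ↔ v ∈ F.leaves := by
  induction F <;> simp_all [subs, leaves]

theorem disjoint_subs {A B : FTree V} (h : A.leaves.Disjoint B.leaves) :
    A.subs.Disjoint B.subs := fun T hA hB =>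
  h ((sublist_leaves_of_mem_subs hA).subset (head_mem_leaves T))
    ((sublist_leaves_of_mem_subs hB).subset (head_mem_leaves T))

/-- The root has more inner nodes than any proper subtree, and the subtrees of the two children have
disjoint, nonempty sets of leaves. -/
theorem nodup_subs {F : FTree V} (h : F.leaves.Nodup) : F.subs.Nodup := by
  induction F with
  | leaf a => simp [subs]
  | tens A B ihA ihB | par A B ihA ihB =>
    obtain ⟨hA, hB, hd⟩ := List.nodup_append'.1 h
    refine List.nodup_cons.2 ⟨fun hm => ?_, List.nodup_append'.2 ⟨ihA hA, ihB hB, disjoint_subs hd⟩⟩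
    obtain hm | hm := List.mem_append.1 hm <;>
    · have := innerCount_le_of_mem_subs hm
      simp only [innerCount] at this
      omega

theorem nodup_flatMap_subs {L : List (FTree V)} (h : (L.flatMap leaves).Nodup) :
    (L.flatMap subs).Nodup := by
  rw [List.nodup_flatMap] at h ⊢
  exact ⟨fun F hF => nodup_subs (h.1 F hF), h.2.imp disjoint_subs⟩

theorem length_subs (F : FTree V) : F.subs.length = F.leaves.length + F.innerCount := by
  induction F <;> simp_all [subs, leaves, innerCount] <;> omega

/-- The children to which the edges are kept by the switching `s`. -/
def FTree.children (s : FTree V → Bool) : FTree V → List (FTree V)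
  | leaf _ => []
  | tens A B => [A, B]
  | par A B => [if s (par A B) then A else B]

theorem innerCount_lt_of_mem_children {s : FTree V → Bool} {A T : FTree V}
    (h : A ∈ T.children s) : A.innerCount < T.innerCount := by
  cases T with
  | leaf a => simp [children] at h
  | tens B C =>
    simp only [children, List.mem_cons, List.not_mem_nil, or_false] at h
    obtain rfl | rfl := h <;> simp only [innerCount] <;> omega
  | par B C =>
    rw [children, List.mem_singleton] at h
    split_ifs at h <;> subst h <;> simp only [innerCount] <;> omega

theorem mem_subs_of_mem_children {s : FTree V → Bool} {A T F : FTree V} (hT : T ∈ F.subs)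
    (h : A ∈ T.children s) : A ∈ F.subs := by
  induction F with
  | leaf a =>
    obtain rfl := List.mem_singleton.1 hT
    simp [children] at h
  | tens B C ihB ihC =>
    simp only [subs, List.mem_cons, List.mem_append] at hT ⊢
    obtain rfl | hT | hT := hT
    · simp only [children, List.mem_cons, List.not_mem_nil, or_false] at h
      obtain rfl | rfl := h <;> simp [self_mem_subs]
    · simp [ihB hT]
    · simp [ihC hT]
  | par B C ihB ihC =>
    simp only [subs, List.mem_cons, List.mem_append] at hT ⊢
    obtain rfl | hT | hT := hT
    · rw [children, List.mem_singleton] at h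
      split_ifs at h <;> subst h <;> simp [self_mem_subs]
    · simp [ihB hT]
    · simp [ihC hT]

theorem nodup_children {s : FTree V → Bool} {T : FTree V} (h : T.leaves.Nodup) :
    (T.children s).Nodup := by
  cases T with
  | leaf a => simp [children]
  | tens A B =>
    have hne : A ≠ B := by
      rintro rfl
      exact (List.nodup_append'.1 h).2.2 (head_mem_leaves A) (head_mem_leaves A)
    simp [children, hne]
  | par A B => simp [children]

/-- Each inner node keeps one edge to a child, and each ⊗ one more; the total does not depend on
`s`. -/
theorem sum_length_children (s : FTree V → Bool) (F : FTree V) :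
    (F.subs.map fun T => (T.children s).length).sum = F.tensCount + F.innerCount := by
  induction F <;> simp_all [subs, children, tensCount, innerCount] <;> omega

/-- The leaf with which the root is connected in the switching `s`. -/
def FTree.rep (s : FTree V → Bool) : FTree V → V
  | leaf a => a
  | tens A _ => rep s A
  | par A B => if s (par A B) then rep s A else rep s B

/-- The edges between leaves in the switching `s`. -/
def FTree.repEdges (s : FTree V → Bool) : FTree V → Multiset (V × V)
  | leaf _ => 0
  | tens A B => (rep s A, rep s B) ::ₘ (repEdges s A + repEdges s B)
  | par A B => repEdges s A + repEdges s B

theorem sw_rep (s : FTree V → Bool) (T : FTree V) : Sw T (T.rep s) (T.repEdges s) := by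
  induction T with
  | leaf a => exact .leaf a
  | tens A B hA hB => exact .tens hA hB
  | par A B hA hB =>
    rw [rep, repEdges]
    split_ifs
    · exact .parLeft hA hB
    · exact .parRight hA hB

theorem rep_congr {s s' : FTree V → Bool} {T : FTree V} (h : ∀ A ∈ T.subs, s A = s' A) :
    T.rep s = T.rep s' ∧ T.repEdges s = T.repEdges s' := by
  induction T with
  | leaf a => exact ⟨rfl, rfl⟩
  | tens A B ihA ihB | par A B ihA ihB =>
    simp only [subs, List.mem_cons, List.mem_append] at h
    obtain ⟨h₁, h₂⟩ := ihA fun C hC => h C (by simp [hC])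
    obtain ⟨h₃, h₄⟩ := ihB fun C hC => h C (by simp [hC])
    simp [rep, repEdges, h₁, h₂, h₃, h₄, h _ (.inl rfl)]

open Classical in
-- The inductive switchings choose independently at each occurrence, whereas `s` is a function of
-- the subtree. With distinct leaves, different occurrences are different subtrees, so choices for
-- the two children and for the root can be pasted together.
theorem Sw.exists_switching {T : FTree V} {r : V} {E : Multiset (V × V)} (h : Sw T r E)
    (hT : T.leaves.Nodup) : ∃ s, T.rep s = r ∧ T.repEdges s = E := by
  have combine : ∀ {A B : FTree V} (C : FTree V) (b : Bool) (s₁ s₂ : FTree V → Bool),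
      A.leaves.Disjoint B.leaves → C ∉ A.subs → C ∉ B.subs →
      ∃ s : FTree V → Bool, s C = b ∧ (A.rep s = A.rep s₁ ∧ A.repEdges s = A.repEdges s₁) ∧
        (B.rep s = B.rep s₂ ∧ B.repEdges s = B.repEdges s₂) := by
    intro A B C b s₁ s₂ hd hA hB
    refine ⟨fun D => if D = C then b else if D ∈ A.subs then s₁ D else s₂ D, by simp,
      rep_congr fun D hD => ?_, rep_congr fun D hD => ?_⟩
    · have : D ≠ C := by rintro rfl; exact hA hD
      simp [this, hD]
    · have h₁ : D ≠ C := by rintro rfl; exact hB hD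
      have h₂ : D ∉ A.subs := fun h => disjoint_subs hd h hD
      simp [h₁, h₂]
  induction h with
  | leaf a => exact ⟨fun _ => true, rfl, rfl⟩
  | @tens A B a b E F _ _ ihA ihB =>
    have hn := List.nodup_cons.1 (nodup_subs hT)
    obtain ⟨hA, hB, hd⟩ := List.nodup_append'.1 hT
    obtain ⟨s₁, rfl, rfl⟩ := ihA hA
    obtain ⟨s₂, rfl, rfl⟩ := ihB hB
    obtain ⟨s, -, h₁, h₂⟩ := combine (FTree.tens A B) true s₁ s₂ hd
      (fun h => hn.1 (by simp [h])) (fun h => hn.1 (by simp [h]))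
    exact ⟨s, by simp [rep, h₁.1], by simp [repEdges, h₁, h₂]⟩
  | @parLeft A B a b E F _ _ ihA ihB =>
    have hn := List.nodup_cons.1 (nodup_subs hT)
    obtain ⟨hA, hB, hd⟩ := List.nodup_append'.1 hT
    obtain ⟨s₁, rfl, rfl⟩ := ihA hA
    obtain ⟨s₂, rfl, rfl⟩ := ihB hB
    obtain ⟨s, hs, h₁, h₂⟩ := combine (FTree.par A B) true s₁ s₂ hd
      (fun h => hn.1 (by simp [h])) (fun h => hn.1 (by simp [h]))
    exact ⟨s, by simp [rep, h₁.1, hs], by simp [repEdges, h₁, h₂]⟩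
  | @parRight A B a b E F _ _ ihA ihB =>
    have hn := List.nodup_cons.1 (nodup_subs hT)
    obtain ⟨hA, hB, hd⟩ := List.nodup_append'.1 hT
    obtain ⟨s₁, rfl, rfl⟩ := ihA hA
    obtain ⟨s₂, rfl, rfl⟩ := ihB hB
    obtain ⟨s, hs, h₁, h₂⟩ := combine (FTree.par A B) false s₁ s₂ hd
      (fun h => hn.1 (by simp [h])) (fun h => hn.1 (by simp [h]))
    exact ⟨s, by simp [rep, h₂.1, hs], by simp [repEdges, h₁, h₂]⟩

/-- The edges between leaves of a forest in the switching `s`. -/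
def forestEdges (s : FTree V → Bool) (L : List (FTree V)) : Multiset (V × V) :=
  (L.map (repEdges s)).sum

theorem swF_forestEdges (s : FTree V → Bool) (L : List (FTree V)) :
    SwF (L : Multiset (FTree V)) (forestEdges s L) := by
  induction L with
  | nil => exact .zero
  | cons T L ih => exact .cons (sw_rep s T) ih

open Classical in
theorem SwF.exists_switching {L : List (FTree V)} {F : Multiset (V × V)}
    (h : SwF (L : Multiset (FTree V)) F) (hL : (L.flatMap leaves).Nodup) :
    ∃ s, forestEdges s L = F := by
  induction L generalizing F with
  | nil =>
    refine ⟨fun _ => true, ?_⟩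
    generalize hM : ((([] : List (FTree V)) : Multiset (FTree V))) = M at h
    cases h with
    | zero => rfl
    | cons => simp at hM
  | cons T L ih =>
    rw [List.flatMap_cons] at hL
    obtain ⟨hT, hL, hd⟩ := List.nodup_append'.1 hL
    obtain ⟨a, E, F', hE, hF', rfl⟩ := SwF.cons_inv (A := T) (M := L) h
    obtain ⟨s₁, -, rfl⟩ := hE.exists_switching hT
    obtain ⟨s₂, rfl⟩ := ih hF' hL
    refine ⟨fun D => if D ∈ T.subs then s₁ D else s₂ D, ?_⟩
    rw [forestEdges, forestEdges, List.map_cons, List.sum_cons]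
    congr 1
    · exact (rep_congr fun D hD => by simp [hD]).2
    · congr 1
      refine List.map_congr_left fun U hU => (rep_congr fun D hD => ?_).2
      have : D ∉ T.subs := fun h => disjoint_subs
        (fun v hv hv' => hd hv (List.mem_flatMap.2 ⟨U, hU, hv'⟩)) h hD
      simp [this]

theorem repEdges_le_of_mem_subs {s : FTree V → Bool} {T F : FTree V} (h : T ∈ F.subs) :
    T.repEdges s ≤ F.repEdges s := by
  induction F with
  | leaf a => rw [List.mem_singleton.1 h]
  | tens B C ihB ihC =>
    simp only [subs, List.mem_cons, List.mem_append] at h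
    obtain rfl | h | h := h
    · exact le_rfl
    · exact (ihB h).trans ((Multiset.le_add_right _ _).trans (Multiset.le_cons_self _ _))
    · exact (ihC h).trans ((Multiset.le_add_left _ _).trans (Multiset.le_cons_self _ _))
  | par B C ihB ihC =>
    simp only [subs, List.mem_cons, List.mem_append] at h
    obtain rfl | h | h := h
    · exact le_rfl
    · exact (ihB h).trans (Multiset.le_add_right _ _)
    · exact (ihC h).trans (Multiset.le_add_left _ _)

theorem exists_tens_of_mem_repEdges {s : FTree V → Bool} {e : V × V} {F : FTree V}
    (h : e ∈ F.repEdges s) : ∃ A B, FTree.tens A B ∈ F.subs ∧ e = (A.rep s, B.rep s) := by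
  induction F with
  | leaf a => simp [repEdges] at h
  | tens B C ihB ihC =>
    simp only [repEdges, Multiset.mem_cons, Multiset.mem_add] at h
    obtain rfl | h | h := h
    · exact ⟨B, C, by simp [subs], rfl⟩
    · obtain ⟨A, A', h', rfl⟩ := ihB h
      exact ⟨A, A', by simp [subs, h'], rfl⟩
    · obtain ⟨A, A', h', rfl⟩ := ihC h
      exact ⟨A, A', by simp [subs, h'], rfl⟩
  | par B C ihB ihC =>
    simp only [repEdges, Multiset.mem_add] at h
    obtain h | h := h
    · obtain ⟨A, A', h', rfl⟩ := ihB h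
      exact ⟨A, A', by simp [subs, h'], rfl⟩
    · obtain ⟨A, A', h', rfl⟩ := ihC h
      exact ⟨A, A', by simp [subs, h'], rfl⟩

theorem mem_forestEdges {s : FTree V → Bool} {L : List (FTree V)} {e : V × V} :
    e ∈ forestEdges s L ↔ ∃ F ∈ L, e ∈ F.repEdges s := by
  induction L <;> simp_all [forestEdges]

end Subtrees

/-! ### Switching graphs: connectedness after contraction, and counting edges. -/

section Graphs

variable {V : Type*}

/-- The subtrees of a forest. -/
abbrev Subtree (L : List (FTree V)) := {T : FTree V // T ∈ L.flatMap subs}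

/-- The edges of a switching of a forest. -/
inductive TreeEdge (link : V → V) (s : FTree V → Bool) : FTree V → FTree V → Prop
  | link (v : V) : TreeEdge link s (leaf v) (leaf (link v))
  | child {A T : FTree V} : A ∈ T.children s → TreeEdge link s T A

/-- The switching `s` of a forest with identity links, as a graph. -/
def forestGraph (L : List (FTree V)) (link : V → V) (s : FTree V → Bool) :
    SimpleGraph (Subtree L) :=
  SimpleGraph.fromRel fun A B => TreeEdge link s A.1 B.1

/-- Leaves which are joined by a link are identified. -/
def linkSetoid (link : V → V) (h : ∀ v, link (link v) = v) : Setoid V where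
  r x y := y = x ∨ y = link x
  iseqv :=
    { refl := fun _ => .inl rfl
      symm := by
        rintro x y (rfl | rfl)
        · exact .inl rfl
        · exact .inr (h x).symm
      trans := by
        rintro x y z (rfl | rfl) (rfl | rfl)
        · exact .inl rfl
        · exact .inr rfl
        · exact .inr rfl
        · exact .inl (h x) }

namespace forestGraph

variable {L : List (FTree V)} {link : V → V} {s : FTree V → Bool}

theorem adj_iff (hne : ∀ v, link v ≠ v) {A B : Subtree L} :
    (forestGraph L link s).Adj A B ↔ TreeEdge link s A.1 B.1 ∨ TreeEdge link s B.1 A.1 := by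
  rw [forestGraph, SimpleGraph.fromRel_adj, and_iff_right_iff_imp]
  have key : ∀ C D : FTree V, TreeEdge link s C D → C ≠ D := by
    intro C D h hCD
    cases h with
    | link v => exact hne v (leaf.inj hCD).symm
    | child h =>
      subst hCD
      exact (innerCount_lt_of_mem_children h).false
  rintro (h | h) rfl
  · exact key _ _ h rfl
  · exact key _ _ h rfl

theorem leaf_mem (hex : ∀ v, v ∈ L.flatMap leaves) (v : V) : leaf v ∈ L.flatMap subs := by
  obtain ⟨F, hF, hv⟩ := List.mem_flatMap.1 (hex v)
  exact List.mem_flatMap.2 ⟨F, hF, leaf_mem_subs.2 hv⟩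

theorem child_mem {A T : FTree V} (hT : T ∈ L.flatMap subs) (h : A ∈ T.children s) :
    A ∈ L.flatMap subs := by
  obtain ⟨F, hF, hT⟩ := List.mem_flatMap.1 hT
  exact List.mem_flatMap.2 ⟨F, hF, mem_subs_of_mem_children hT h⟩

/-- Links stay within a block, a left edge of a ⊗ and a kept edge of a ⅋ preserve the representative
leaf, and the right edge of a ⊗ is an edge of the contracted graph. -/
theorem conn_of_treeEdge {ι : Type*} {q : V → ι} (hq : ∀ v, q (link v) = q v) {A B : FTree V}
    (hA : A ∈ L.flatMap subs) (h : TreeEdge link s A B) :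
    Conn ((forestEdges s L).map (Prod.map q q)) (q (A.rep s)) (q (B.rep s)) := by
  cases h with
  | link v => rw [rep, rep, hq]; exact .refl _
  | child h =>
    cases A with
    | leaf a => simp [children] at h
    | tens C D =>
      simp only [children, List.mem_cons, List.not_mem_nil, or_false] at h
      obtain rfl | rfl := h
      · exact .refl _
      · obtain ⟨F, hF, hA⟩ := List.mem_flatMap.1 hA
        refine Conn.edge (Multiset.mem_map.2 ⟨(C.rep s, B.rep s), ?_, rfl⟩)
        exact mem_forestEdges.2 ⟨F, hF, Multiset.mem_of_le (repEdges_le_of_mem_subs hA)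
          (by simp [repEdges])⟩
    | par C D =>
      rw [children, List.mem_singleton] at h
      subst h
      rw [rep]
      split_ifs <;> exact .refl _

theorem conn_of_connected {ι : Type*} {q : V → ι} (hq : ∀ v, q (link v) = q v)
    (hne : ∀ v, link v ≠ v) (h : (forestGraph L link s).Connected) {x y : V}
    (hx : leaf x ∈ L.flatMap subs) (hy : leaf y ∈ L.flatMap subs) :
    Conn ((forestEdges s L).map (Prod.map q q)) (q x) (q y) := by
  have key : ∀ A B : Subtree L, (forestGraph L link s).Reachable A B →
      Conn ((forestEdges s L).map (Prod.map q q)) (q (A.1.rep s)) (q (B.1.rep s)) := by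
    rintro A B ⟨w⟩
    induction w with
    | nil => exact .refl _
    | cons hadj _ ih =>
      refine .trans _ _ _ ?_ ih
      obtain h | h := (adj_iff hne).1 hadj
      · exact conn_of_treeEdge hq (Subtype.prop _) h
      · exact .symm _ _ (conn_of_treeEdge hq (Subtype.prop _) h)
  exact key ⟨leaf x, hx⟩ ⟨leaf y, hy⟩ (h.preconnected _ _)

theorem reachable_child (hne : ∀ v, link v ≠ v) {T A : FTree V} (hT : T ∈ L.flatMap subs)
    (h : A ∈ T.children s) :
    (forestGraph L link s).Reachable ⟨T, hT⟩ ⟨A, child_mem hT h⟩ :=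
  ((adj_iff hne).2 (.inl (.child h)) : (forestGraph L link s).Adj ⟨T, hT⟩ ⟨A, _⟩).reachable

theorem reachable_rep (hex : ∀ v, v ∈ L.flatMap leaves) (hne : ∀ v, link v ≠ v) (T : FTree V)
    (hT : T ∈ L.flatMap subs) :
    (forestGraph L link s).Reachable ⟨T, hT⟩ ⟨leaf (T.rep s), leaf_mem hex _⟩ := by
  induction T with
  | leaf a => exact .refl _
  | tens A B ihA ihB =>
    have h : A ∈ (FTree.tens A B).children s := by simp [children]
    exact (reachable_child hne hT h).trans (ihA _)
  | par A B ihA ihB =>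
    by_cases hs : s (FTree.par A B) = true
    · have h : A ∈ (FTree.par A B).children s := by simp [children, hs]
      simp only [rep, hs, if_true]
      exact (reachable_child hne hT h).trans (ihA _)
    · have h : B ∈ (FTree.par A B).children s := by simp [children, hs]
      simp only [rep, hs]
      exact (reachable_child hne hT h).trans (ihB _)

theorem connected_of_conn (hex : ∀ v, v ∈ L.flatMap leaves) (hne : ∀ v, link v ≠ v)
    (hlink : ∀ v, link (link v) = v) [Nonempty V]
    (h : ∀ x y, Conn ((forestEdges s L).map
      (Prod.map (Quotient.mk (linkSetoid link hlink)) (Quotient.mk (linkSetoid link hlink))))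
      (Quotient.mk (linkSetoid link hlink) x) (Quotient.mk (linkSetoid link hlink) y)) :
    (forestGraph L link s).Connected := by
  set q := Quotient.mk (linkSetoid link hlink)
  have same : ∀ x y, q x = q y →
      (forestGraph L link s).Reachable ⟨leaf x, leaf_mem hex x⟩ ⟨leaf y, leaf_mem hex y⟩ := by
    intro x y hxy
    obtain rfl | rfl : y = x ∨ y = link x := Quotient.exact hxy
    · exact .refl _
    · exact ((adj_iff hne).2 (.inl (.link x)) : (forestGraph L link s).Adj
        ⟨leaf x, leaf_mem hex x⟩ ⟨leaf (link x), leaf_mem hex _⟩).reachable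
  have key : ∀ i j, Conn ((forestEdges s L).map (Prod.map q q)) i j → ∀ x y, q x = i → q y = j →
      (forestGraph L link s).Reachable ⟨leaf x, leaf_mem hex x⟩ ⟨leaf y, leaf_mem hex y⟩ := by
    intro i j hij
    induction hij with
    | rel i j h =>
      intro x y hx hy
      obtain ⟨e, he, hij⟩ := Multiset.mem_map.1 h
      obtain ⟨F, hF, he⟩ := mem_forestEdges.1 he
      obtain ⟨A, B, hAB, rfl⟩ := exists_tens_of_mem_repEdges he
      simp only [Prod.map_apply, Prod.mk.injEq] at hij
      have hT : FTree.tens A B ∈ L.flatMap subs := List.mem_flatMap.2 ⟨F, hF, hAB⟩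
      have hA : A ∈ (FTree.tens A B).children s := by simp [children]
      have hB : B ∈ (FTree.tens A B).children s := by simp [children]
      -- A contracted edge is lifted to the path from the representative of `A` up to `A`, over `A ⊗
      -- B` to `B`, and down to the representative of `B`.
      exact (same _ _ (hx.trans hij.1.symm)).trans <| (reachable_rep hex hne A _).symm.trans <|
        (reachable_child hne hT hA).symm.trans <| (reachable_child hne hT hB).trans <|
        (reachable_rep hex hne B _).trans (same _ _ (hij.2.trans hy.symm))
    | refl i => exact fun x y hx hy => same x y (hx.trans hy.symm)
    | symm i j _ ih => exact fun x y hx hy => (ih y x hy hx).symm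
    | trans i j k _ _ ih₁ ih₂ =>
      intro x y hx hy
      obtain ⟨z, hz⟩ := Quotient.exists_rep j
      exact (ih₁ x z hx hz).trans (ih₂ z y hz hy)
  refine (SimpleGraph.connected_iff _).2 ⟨fun A B => ?_, ⟨⟨_, leaf_mem hex (Classical.arbitrary V)⟩⟩⟩
  exact (reachable_rep hex hne A.1 A.2).trans
    ((key _ _ (h _ _) _ _ rfl rfl).trans (reachable_rep hex hne B.1 B.2).symm)

/-- The pairs of a subtree and one of its children in the switching `s`. -/
def childPairs (L : List (FTree V)) (s : FTree V → Bool) : List (FTree V × FTree V) :=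
  (L.flatMap subs).flatMap fun T => (T.children s).map (Prod.mk T)

theorem mem_childPairs {e : FTree V × FTree V} :
    e ∈ childPairs L s ↔ e.1 ∈ L.flatMap subs ∧ e.2 ∈ e.1.children s := by
  obtain ⟨a, b⟩ := e
  simp only [childPairs, List.mem_flatMap (l := L.flatMap subs), List.mem_map, Prod.mk.injEq]
  constructor
  · rintro ⟨T, hT, A, hA, rfl, rfl⟩
    exact ⟨hT, hA⟩
  · rintro ⟨hT, hA⟩
    exact ⟨a, hT, b, hA, rfl, rfl⟩

theorem nodup_childPairs (hn : (L.flatMap leaves).Nodup) : (childPairs L s).Nodup := by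
  rw [childPairs, List.nodup_flatMap]
  refine ⟨fun T hT => (nodup_children ?_).map (Prod.mk_right_injective T), ?_⟩
  · obtain ⟨F, hF, hT⟩ := List.mem_flatMap.1 hT
    exact ((List.nodup_flatMap.1 hn).1 F hF).sublist (sublist_leaves_of_mem_subs hT)
  · refine (nodup_flatMap_subs hn).imp fun {T U} hTU e he he' => ?_
    obtain ⟨_, _, rfl⟩ := List.mem_map.1 he
    obtain ⟨_, _, h⟩ := List.mem_map.1 he'
    exact hTU (congrArg Prod.fst h).symm

theorem length_childPairs : (childPairs L s).length =
    tensCountM (L : Multiset (FTree V)) + innerCountM (L : Multiset (FTree V)) := by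
  induction L with
  | nil => rfl
  | cons T L ih =>
    rw [childPairs, List.flatMap_cons, List.flatMap_append, List.length_append]
    change _ + (childPairs L s).length = _
    rw [ih, ← Multiset.cons_coe, tensCountM_cons, innerCountM_cons, List.length_flatMap]
    simp only [List.length_map]
    rw [sum_length_children]
    omega

theorem length_flatMap_subs : (L.flatMap subs).length =
    (L.flatMap leaves).length + innerCountM (L : Multiset (FTree V)) := by
  induction L with
  | nil => rfl
  | cons T L ih =>
    rw [List.flatMap_cons, List.flatMap_cons, List.length_append, List.length_append, ih,
      ← Multiset.cons_coe, innerCountM_cons, length_subs]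
    omega

/-- The oriented edges of `forestGraph`. -/
def darts (L : List (FTree V)) (link : V → V) (s : FTree V → Bool) : List (FTree V × FTree V) :=
  (L.flatMap leaves).map (fun v => (leaf v, leaf (link v))) ++
    (childPairs L s ++ (childPairs L s).map Prod.swap)

/-- A child has fewer inner nodes than its parent, so no child edge coincides with a reversed one;
links start and end at leaves, which have no children. Both orientations of a link are listed once,
at its two ends. -/
theorem nodup_darts (hn : (L.flatMap leaves).Nodup) : (darts L link s).Nodup := by
  have hc := nodup_childPairs (s := s) hn
  refine List.nodup_append'.2 ⟨hn.map ?_, List.nodup_append'.2 ⟨hc, hc.map Prod.swap_injective, ?_⟩,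
    ?_⟩
  · intro v w h
    exact leaf.inj (congrArg Prod.fst h)
  · intro e he he'
    obtain ⟨e', h', rfl⟩ := List.mem_map.1 he'
    have h₁ := innerCount_lt_of_mem_children (mem_childPairs.1 he).2
    have h₂ := innerCount_lt_of_mem_children (mem_childPairs.1 h').2
    simp only [Prod.fst_swap, Prod.snd_swap] at h₁
    omega
  · intro e he he'
    obtain ⟨v, _, rfl⟩ := List.mem_map.1 he
    obtain he' | he' := List.mem_append.1 he'
    · have := (mem_childPairs.1 he').2
      simp [children] at this
    · obtain ⟨e, he, hv⟩ := List.mem_map.1 he'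
      have := (mem_childPairs.1 he).2
      rw [show e.1 = leaf (link v) from congrArg Prod.snd hv] at this
      simp [children] at this

theorem mem_darts (hex : ∀ v, v ∈ L.flatMap leaves) (hlink : ∀ v, link (link v) = v)
    {e : FTree V × FTree V} : e ∈ darts L link s ↔
      (e.1 ∈ L.flatMap subs ∧ e.2 ∈ L.flatMap subs) ∧
        (TreeEdge link s e.1 e.2 ∨ TreeEdge link s e.2 e.1) := by
  rw [darts, List.mem_append, List.mem_append, mem_childPairs]
  constructor
  · rintro (h | h | h)
    · obtain ⟨v, _, rfl⟩ := List.mem_map.1 h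
      exact ⟨⟨leaf_mem hex _, leaf_mem hex _⟩, .inl (.link v)⟩
    · exact ⟨⟨h.1, child_mem h.1 h.2⟩, .inl (.child h.2)⟩
    · obtain ⟨e, he, rfl⟩ := List.mem_map.1 h
      have h := mem_childPairs.1 he
      exact ⟨⟨child_mem h.1 h.2, h.1⟩, .inr (.child h.2)⟩
  · obtain ⟨a, b⟩ := e
    rintro ⟨⟨ha, hb⟩, h | h⟩
    · cases h with
      | link v => exact .inl (List.mem_map.2 ⟨v, hex v, rfl⟩)
      | child h => exact .inr (.inl ⟨ha, h⟩)
    · cases h with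
      | link v => exact .inl (List.mem_map.2 ⟨link v, hex _, by rw [hlink]⟩)
      | child h =>
        exact .inr (.inr (List.mem_map.2 ⟨(b, a), mem_childPairs.2 ⟨hb, h⟩, rfl⟩))

theorem _root_.List.Nodup.card_subtype_mem {α : Type*} {l : List α} (h : l.Nodup) :
    Nat.card {x // x ∈ l} = l.length := by
  classical
  rw [← Nat.card_congr (h.getEquiv), Nat.card_fin]

open Classical in
theorem card_edges (hn : (L.flatMap leaves).Nodup) (hex : ∀ v, v ∈ L.flatMap leaves)
    (hne : ∀ v, link v ≠ v) (hlink : ∀ v, link (link v) = v) :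
    2 * Nat.card (forestGraph L link s).edgeSet = (darts L link s).length := by
  have : Fintype (Subtree L) := List.Subtype.fintype _
  have h := (forestGraph L link s).dart_card_eq_twice_card_edges
  rw [SimpleGraph.edgeFinset_card, ← Nat.card_eq_fintype_card, ← Nat.card_eq_fintype_card] at h
  rw [← h, ← (nodup_darts hn).card_subtype_mem]
  refine Nat.card_congr (Equiv.ofBijective (fun d => ⟨(d.fst.1, d.snd.1), ?_⟩) ⟨?_, ?_⟩)
  · exact (mem_darts hex hlink).2 ⟨⟨d.fst.2, d.snd.2⟩, (adj_iff hne).1 d.adj⟩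
  · intro d d' h
    simp only [Subtype.mk.injEq, Prod.mk.injEq] at h
    ext1
    exact Prod.ext (Subtype.ext h.1) (Subtype.ext h.2)
  · rintro ⟨⟨a, b⟩, h⟩
    obtain ⟨⟨ha, hb⟩, h⟩ := (mem_darts hex hlink).1 h
    exact ⟨⟨⟨⟨a, ha⟩, ⟨b, hb⟩⟩, (adj_iff hne).2 h⟩, rfl⟩

/-- With `l` leaves, `t` tensors and `i` inner nodes there are `l + i` vertices and `l / 2 + t + i`
edges; `i` cancels, and the condition is independent of the switching. -/
theorem card_edges_add_one_iff (hn : (L.flatMap leaves).Nodup) (hex : ∀ v, v ∈ L.flatMap leaves)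
    (hne : ∀ v, link v ≠ v) (hlink : ∀ v, link (link v) = v) :
    Nat.card (forestGraph L link s).edgeSet + 1 = Nat.card (Subtree L) ↔
      2 * tensCountM (L : Multiset (FTree V)) + 2 = (L.flatMap leaves).length := by
  classical
  have h₁ := card_edges (s := s) hn hex hne hlink
  have h₂ : Nat.card (Subtree L) = (L.flatMap subs).length :=
    (nodup_flatMap_subs hn).card_subtype_mem
  rw [length_flatMap_subs] at h₂
  simp only [darts, List.length_append, List.length_map, length_childPairs] at h₁
  omega

theorem isTree_iff (hn : (L.flatMap leaves).Nodup) (hex : ∀ v, v ∈ L.flatMap leaves)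
    (hne : ∀ v, link v ≠ v) (hlink : ∀ v, link (link v) = v) :
    (forestGraph L link s).IsTree ↔ (forestGraph L link s).Connected ∧
      2 * tensCountM (L : Multiset (FTree V)) + 2 = (L.flatMap leaves).length := by
  classical
  have : Fintype (Subtree L) := List.Subtype.fintype _
  rw [SimpleGraph.isTree_iff_connected_and_card, card_edges_add_one_iff hn hex hne hlink]

end forestGraph

theorem coe_flatMap_leaves (L : List (FTree V)) :
    ((L.flatMap leaves : List V) : Multiset V) = leavesM (L : Multiset (FTree V)) := by
  rw [leavesM, Multiset.coe_bind]

/-- The switching criterion in terms of connectedness of leaves and the number of `⊗`-nodes. -/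
theorem forall_isTree_iff {L : List (FTree V)} {link : V → V} (hn : (L.flatMap leaves).Nodup)
    (hex : ∀ v, v ∈ L.flatMap leaves)
    (hne : ∀ v, link v ≠ v) (hlink : ∀ v, link (link v) = v) :
    (∀ s, (forestGraph L link s).IsTree) ↔
      ConnM (Quotient.mk (linkSetoid link hlink)) (L : Multiset (FTree V)) ∧
      2 * tensCountM (L : Multiset (FTree V)) + 2 = Multiset.card (leavesM (L : Multiset (FTree V))) := by
  simp only [forestGraph.isTree_iff hn hex hne hlink, ← coe_flatMap_leaves, Multiset.coe_card]
  constructor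
  · refine fun h => ⟨fun F hF x _ y _ => ?_, (h fun _ => true).2⟩
    obtain ⟨s, rfl⟩ := hF.exists_switching hn
    exact forestGraph.conn_of_connected (fun v => Quotient.sound (Or.inr (hlink v).symm)) hne (h s).1
      (forestGraph.leaf_mem hex x) (forestGraph.leaf_mem hex y)
  · rintro ⟨hc, hcard⟩ s
    -- The count gives at least two leaves; this supplies the nonemptiness that connectedness
    -- includes.
    obtain ⟨v, -⟩ := List.exists_mem_of_length_pos (l := L.flatMap leaves) (by omega)
    have : Nonempty V := ⟨v⟩
    have hm : ∀ v, v ∈ leavesM (L : Multiset (FTree V)) := fun v => by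
      rw [← coe_flatMap_leaves]; exact hex v
    exact ⟨forestGraph.connected_of_conn hex hne hlink fun x y =>
      hc _ (swF_forestEdges s L) x (hm x) y (hm y), hcard⟩

end Graphs

/-! ### From nets to forests and the equivalence of all notions. -/

section Nets

variable {V : Type*}

/-- The tree which is rooted at a node; the cut of `A` and `B` becomes `A ⊗ B`. -/
def Node.tree : Node V → FTree V
  | .sub A => A
  | .cut A B => tens A B

namespace PreProofNet

variable (π : PreProofNet V)

/-- The forest of a net, with cuts seen as `⊗`-trees. -/
def forest : List (FTree V) := π.concl ++ π.cuts.map fun c => tens c.1 c.2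

/-- The list of nodes of a net. -/
def nodes : List (Node V) :=
  (π.concl.flatMap fun F => F.subs.map Node.sub) ++
    π.cuts.flatMap fun c => Node.cut c.1 c.2 :: (c.1.subs ++ c.2.subs).map Node.sub

theorem flatMap_leaves_forest : π.forest.flatMap leaves =
    π.concl.flatMap FTree.leaves ++ π.cuts.flatMap fun c => c.1.leaves ++ c.2.leaves := by
  rw [forest, List.flatMap_append, List.flatMap_map]
  rfl

theorem map_tree_nodes : π.nodes.map Node.tree = π.forest.flatMap subs := by
  have h : Node.tree ∘ Node.sub = (id : FTree V → FTree V) := rfl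
  rw [forest, nodes, List.flatMap_append, List.flatMap_map, List.map_append, List.map_flatMap,
    List.map_flatMap]
  simp [h, subs, Node.tree]

theorem mem_nodes {n : Node V} : n ∈ π.nodes ↔ π.IsNode n := by
  rw [nodes, List.mem_append, List.mem_flatMap, List.mem_flatMap]
  cases n with
  | sub A => simp [IsNode, mem_subs]
  | cut A B =>
    simp only [IsNode, List.mem_map, List.mem_cons, List.mem_append, Node.cut.injEq]
    constructor
    · rintro (⟨_, _, _, _, h⟩ | ⟨⟨C, D⟩, hc, ⟨rfl, rfl⟩ | ⟨_, _, h⟩⟩)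
      · cases h
      · exact hc
      · cases h
    · exact fun h => .inr ⟨(A, B), h, .inl ⟨rfl, rfl⟩⟩

theorem nodup_forest : (π.forest.flatMap leaves).Nodup := by
  rw [flatMap_leaves_forest]; exact π.nodup

theorem mem_forest_leaves (v : V) : v ∈ π.forest.flatMap leaves := by
  rw [flatMap_leaves_forest]; exact π.exhaust v

theorem link_ne (v : V) : π.link v ≠ v := by
  intro h
  have := π.link_dual v
  rw [h] at this
  cases h' : π.lab v <;> simp [h', Atom.dual] at this

/-- Distinct leaves make all subtrees of the forest distinct, so no information is lost when a cut
node is read as a ⊗; in particular it is not confused with a subformula. -/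
theorem tree_injOn {m n : Node V} (hm : π.IsNode m) (hn : π.IsNode n) (h : m.tree = n.tree) :
    m = n := by
  have hnd : (π.nodes.map Node.tree).Nodup := by
    rw [map_tree_nodes]; exact nodup_flatMap_subs π.nodup_forest
  exact List.inj_on_of_nodup_map hnd (π.mem_nodes.2 hm) (π.mem_nodes.2 hn) h

theorem tree_mem {n : Node V} (hn : π.IsNode n) : n.tree ∈ π.forest.flatMap subs := by
  rw [← map_tree_nodes]
  exact List.mem_map_of_mem (π.mem_nodes.2 hn)

theorem treeEdge_of_edge {s : FTree V → Bool} {m n : Node V} (h : π.Edge s m n) :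
    TreeEdge π.link s m.tree n.tree := by
  cases h with
  | link v => exact .link v
  | tensLeft A B => exact .child (by simp [Node.tree, children])
  | tensRight A B => exact .child (by simp [Node.tree, children])
  | cutLeft A B => exact .child (by simp [Node.tree, children])
  | cutRight A B => exact .child (by simp [Node.tree, children])
  | parLeft A B h => exact .child (by simp [Node.tree, children, h])
  | parRight A B h => exact .child (by simp [Node.tree, children, h])

/-- `hB` and `hA` have content only when `m` is a subformula node, `hc` only when it is a cut node.
-/
theorem isNode_sub_of_isSub {m : Node V} {A B : FTree V} (hm : π.IsNode m)
    (hB : ∀ F, m = .sub F → B ∈ F.subs) (hc : ∀ C D, m = .cut C D → A = C ∨ A = D)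
    (hA : (∀ C D, m ≠ .cut C D) → A = B) : π.IsNode (.sub A) := by
  cases m with
  | sub F =>
    obtain rfl := hA (by simp)
    have hAF := mem_subs.1 (hB F rfl)
    have key : ∀ {F G : FTree V}, A.IsSub F → F.IsSub G → A.IsSub G := by
      intro F G h₁ h₂
      induction G with
      | leaf a => cases h₂; exact h₁
      | tens C D ihC ihD | par C D ihC ihD =>
        obtain rfl | h₂ | h₂ := h₂
        · exact h₁
        · exact .inr (.inl (ihC h₂))
        · exact .inr (.inr (ihD h₂))
    obtain ⟨G, hG, h⟩ | ⟨c, hc, h⟩ := hm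
    · exact .inl ⟨G, hG, key hAF h⟩
    · exact .inr ⟨c, hc, h.imp (key hAF) (key hAF)⟩
  | cut C D =>
    obtain rfl | rfl := hc C D rfl
    · exact .inr ⟨_, hm, .inl (mem_subs.1 (self_mem_subs _))⟩
    · exact .inr ⟨_, hm, .inr (mem_subs.1 (self_mem_subs _))⟩

/-- A child `A` of a node is itself a subformula node, so by `tree_injOn` the node `n` with tree `A`
is that one and not a cut. -/
theorem edge_of_treeEdge {s : FTree V → Bool} {m n : Node V} (hm : π.IsNode m) (hn : π.IsNode n)
    (h : TreeEdge π.link s m.tree n.tree) : π.Edge s m n := by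
  generalize hA : n.tree = A at h
  cases m with
  | sub T =>
    have hsub : ∀ A ∈ T.children s, π.IsNode (.sub A) := fun A hA =>
      π.isNode_sub_of_isSub hm (B := A) (fun F hF => by
        cases hF; exact mem_subs_of_mem_children (self_mem_subs _) hA) (by simp) (fun _ => rfl)
    cases T with
    | leaf v =>
      rw [Node.tree] at h
      cases h with
      | link =>
        cases n with
        | sub B => obtain rfl : B = leaf (π.link v) := hA; exact .link v
        | cut B C => cases hA
      | child h => simp [children] at h
    | tens B C =>
      rw [Node.tree] at h
      cases h with
      | child h =>
        obtain rfl := π.tree_injOn hn (hsub A h) hA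
        simp only [children, List.mem_cons, List.not_mem_nil, or_false] at h
        obtain rfl | rfl := h
        · exact .tensLeft _ _
        · exact .tensRight _ _
    | par B C =>
      rw [Node.tree] at h
      cases h with
      | child h =>
        obtain rfl := π.tree_injOn hn (hsub A h) hA
        rw [children, List.mem_singleton] at h
        split_ifs at h with hs <;> subst h
        · exact .parLeft _ _ hs
        · exact .parRight _ _ (by simpa using hs)
  | cut B C =>
    rw [Node.tree] at h
    cases h with
    | child h =>
      simp only [children, List.mem_cons, List.not_mem_nil, or_false] at h
      have hsub : π.IsNode (.sub A) := π.isNode_sub_of_isSub hm (B := A) (by simp)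
        (fun C D hCD => by cases hCD; exact h) (fun _ => rfl)
      obtain rfl := π.tree_injOn hn hsub hA
      obtain rfl | rfl := h
      · exact .cutLeft _ _
      · exact .cutRight _ _

/-- The switchings of a net and of its forest are isomorphic. -/
noncomputable def switchingIso (s : FTree V → Bool) :
    π.switching s ≃g forestGraph π.forest π.link s where
  toEquiv := Equiv.ofBijective (fun n => ⟨n.1.tree, π.tree_mem n.2⟩) (by
    constructor
    · intro m n h
      exact Subtype.ext (π.tree_injOn m.2 n.2 (congrArg Subtype.val h))
    · rintro ⟨T, hT⟩
      rw [← map_tree_nodes] at hT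
      obtain ⟨n, hn, rfl⟩ := List.mem_map.1 hT
      exact ⟨⟨n, π.mem_nodes.1 hn⟩, rfl⟩)
  map_rel_iff' {m n} := by
    have key : ∀ m n : {n : Node V // π.IsNode n},
        TreeEdge π.link s m.1.tree n.1.tree ↔ π.Edge s m.1 n.1 := fun m n =>
      ⟨π.edge_of_treeEdge m.2 n.2, π.treeEdge_of_edge⟩
    rw [forestGraph, switching, SimpleGraph.fromRel_adj, SimpleGraph.fromRel_adj, ne_eq,
      EmbeddingLike.apply_eq_iff_eq]
    exact and_congr_right fun _ => or_congr (key m n) (key n m)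

theorem correct_iff_isTree :
    π.Correct ↔ ∀ s, (forestGraph π.forest π.link s).IsTree := by
  refine forall_congr' fun s => ?_
  rw [← (π.switchingIso s).isTree_iff, SimpleGraph.isTree_iff]

theorem coe_forest : (π.forest : Multiset (FTree V)) =
    (π.concl : Multiset (FTree V)) + cutTrees (π.cuts : Cuts V) := by
  simp [forest, cutTrees]

/-- The switching criterion in terms of connectedness of leaves and the number of `⊗`-nodes. -/
theorem correct_iff : π.Correct ↔
    ConnM (Quotient.mk (linkSetoid π.link π.link_link)) (π.forest : Multiset (FTree V)) ∧
      2 * tensCountM (π.forest : Multiset (FTree V)) + 2 =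
        Multiset.card (leavesM (π.forest : Multiset (FTree V))) :=
  π.correct_iff_isTree.trans
    (forall_isTree_iff π.nodup_forest π.mem_forest_leaves π.link_ne π.link_link)

theorem correct_of_seq (h : Seq π.lab π.link (π.concl : Multiset (FTree V)) (π.cuts : Cuts V)) :
    π.Correct := by
  rw [correct_iff, coe_forest]
  exact ⟨h.connM fun v => Quotient.sound (Or.inr (π.link_link v).symm), h.card_leaves⟩

end PreProofNet

theorem Sw.of_map {α β : Type*} {g : α → β} {T : FTree α} {r : β} {E : Multiset (β × β)}
    (h : Sw (T.map g) r E) : ∃ r' E', Sw T r' E' ∧ r = g r' ∧ E = E'.map (Prod.map g g) := by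
  induction T generalizing r E with
  | leaf a => cases h; exact ⟨_, _, .leaf a, rfl, rfl⟩
  | tens A B ihA ihB =>
    cases h with
    | tens hA hB =>
      obtain ⟨_, _, hA', rfl, rfl⟩ := ihA hA
      obtain ⟨_, _, hB', rfl, rfl⟩ := ihB hB
      exact ⟨_, _, .tens hA' hB', rfl, by simp⟩
  | par A B ihA ihB =>
    cases h with
    | parLeft hA hB =>
      obtain ⟨_, _, hA', rfl, rfl⟩ := ihA hA
      obtain ⟨_, _, hB', rfl, rfl⟩ := ihB hB
      exact ⟨_, _, .parLeft hA' hB', rfl, by simp⟩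
    | parRight hA hB =>
      obtain ⟨_, _, hA', rfl, rfl⟩ := ihA hA
      obtain ⟨_, _, hB', rfl, rfl⟩ := ihB hB
      exact ⟨_, _, .parRight hA' hB', rfl, by simp⟩

theorem SwF.of_map {α β : Type*} {g : α → β} {M : Multiset (FTree α)} {F : Multiset (β × β)}
    (h : SwF (M.map (FTree.map g)) F) : ∃ F', SwF M F' ∧ F = F'.map (Prod.map g g) := by
  induction M using Multiset.induction generalizing F with
  | empty =>
    generalize hM : (0 : Multiset (FTree α)).map (FTree.map g) = M at h
    cases h with
    | zero => exact ⟨0, .zero, rfl⟩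
    | cons => simp at hM
  | cons T M ih =>
    rw [Multiset.map_cons] at h
    obtain ⟨a, E, F', hT, hM, rfl⟩ := h.cons_inv
    obtain ⟨_, _, hT', rfl, rfl⟩ := hT.of_map
    obtain ⟨_, hM', rfl⟩ := ih hM
    exact ⟨_, .cons hT' hM', by simp⟩

theorem leaves_map {α β : Type*} (g : α → β) (T : FTree α) :
    (T.map g).leaves = T.leaves.map g := by
  induction T <;> simp_all [FTree.map, leaves]

theorem tensCount_map {α β : Type*} (g : α → β) (T : FTree α) :
    (T.map g).tensCount = T.tensCount := by
  induction T <;> simp_all [FTree.map, tensCount]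

theorem leavesM_map {α β : Type*} (g : α → β) (M : Multiset (FTree α)) :
    leavesM (M.map (FTree.map g)) = (leavesM M).map g := by
  simp [leavesM, Multiset.bind_map, Multiset.map_bind, leaves_map]

theorem tensCountM_map {α β : Type*} (g : α → β) (M : Multiset (FTree α)) :
    tensCountM (M.map (FTree.map g)) = tensCountM M := by
  simp [tensCountM, tensCount_map]

theorem join_map_leaf (T : FTree V) : (T.map leaf).join = T := by
  induction T <;> simp_all [FTree.map, join]

/-- The conclusions that stand for cuts are turned back into cuts one at a time by
`Seq.tens_to_cut`. -/
theorem Seq.of_cutTrees {lab : V → Atom} {link : V → V} {G : Multiset (FTree V)}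
    (K : Cuts V) {K' : Cuts V} (hK : ∀ c ∈ K, c.2.map lab = Formula.neg (c.1.map lab))
    (h : Seq lab link (G + cutTrees K) K') : Seq lab link G (K + K') := by
  induction K using Multiset.induction generalizing K' with
  | empty => exact h.congr (by simp [cutTrees]) (by simp)
  | cons c K ih =>
    refine (ih (fun d hd => hK d (Multiset.mem_cons_of_mem hd)) (Seq.tens_to_cut
      (hK c (Multiset.mem_cons_self _ _)) (h.congr ?_ rfl))).congr rfl ?_
    · simp [cutTrees]
    · simp

theorem blockPart_map {α β ι : Type*} (f : α → β) (q : β → ι) (i : ι) (L : Multiset α) :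
    blockPart q i (L.map f) = (blockPart (q ∘ f) i L).map f := by
  rw [blockPart, blockPart, Multiset.filter_map]
  congr!

open Classical in
theorem blockPart_link {ι : Type*} {q : V → ι} {link : V → V} {M : Multiset (FTree V)}
    (hnd : (leavesM M).Nodup) (hex : ∀ v, v ∈ leavesM M) (hne : ∀ v, link v ≠ v)
    (hq : ∀ x y, q y = q x ↔ y = link x ∨ y = x) (x : V) :
    blockPart q (q x) (leavesM M) = {link x, x} := by
  refine (Multiset.Nodup.ext (hnd.filter _) ?_).2 fun y => ?_
  · simpa using hne x
  · simp [hex, hq]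

open Classical in
-- Every block is a pair of distinct linked leaves; together with the leaf count this gives the
-- invariant that there is one block more than there are tensors.
theorem two_mul_card_blocks {ι : Type*} {q : V → ι} {link : V → V} {M : Multiset (FTree V)}
    (hnd : (leavesM M).Nodup) (hex : ∀ v, v ∈ leavesM M) (hne : ∀ v, link v ≠ v)
    (hq : ∀ x y, q y = q x ↔ y = link x ∨ y = x) :
    2 * (blocks q M).card = Multiset.card (leavesM M) := by
  rw [← Multiset.toFinset_card_of_nodup hnd, blocks, Multiset.toFinset_map,
    Finset.card_eq_sum_card_image q (leavesM M).toFinset, mul_comm, ← smul_eq_mul,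
    ← Finset.sum_const]
  refine Finset.sum_congr rfl fun i hi => ?_
  obtain ⟨x, -, rfl⟩ := Finset.mem_image.1 hi
  have h := blockPart_link hnd hex hne hq x
  rw [blockPart] at h
  rw [← Multiset.toFinset_filter, h, Multiset.toFinset_card_of_nodup]
  · rfl
  · simpa using hne x

/-- A correct forest is provable. -/
theorem Seq.of_forest {ι : Type*} {q : V → ι} {lab : V → Atom} {link : V → V}
    {M : Multiset (FTree V)} (hnd : (leavesM M).Nodup) (hex : ∀ v, v ∈ leavesM M)
    (hne : ∀ v, link v ≠ v) (hq : ∀ x y, q y = q x ↔ y = link x ∨ y = x) (hc : ConnM q M)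
    (hn : 2 * tensCountM M + 2 = Multiset.card (leavesM M)) : Seq lab link M 0 := by
  have hbl : (q ∘ head) ∘ leaf = q := rfl
  have hblocks : blocks (q ∘ head) (M.map (FTree.map leaf)) = blocks q M := by
    rw [blocks, blocks, leavesM_map, Multiset.map_map, hbl]
  -- The contraction starts with every leaf as a formula of its own, so that the blocks are exactly
  -- the atomic axioms.
  have hseq : Seq lab link ((M.map (FTree.map leaf)).map join) 0 := by
    refine Seq.of_connM _ _ q rfl ?_ ?_ ?_
    · intro F hF x hx y hy
      obtain ⟨F, hF', rfl⟩ := hF.of_map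
      rw [leavesM_map] at hx hy
      obtain ⟨x, hx', rfl⟩ := Multiset.mem_map.1 hx
      obtain ⟨y, hy', rfl⟩ := Multiset.mem_map.1 hy
      rw [Multiset.map_map, Prod.map_comp_map, hbl]
      exact hc F hF' x hx' y hy'
    · have := two_mul_card_blocks hnd hex hne hq
      rw [tensCountM_map, hblocks]
      omega
    · intro i hi
      rw [hblocks] at hi
      obtain ⟨x, hx, rfl⟩ := mem_blocks.1 hi
      rw [leavesM_map, blockPart_map, hbl, blockPart_link hnd hex hne hq]
      exact (Seq.ax x).congr (by simp) rfl
  rwa [Multiset.map_map, show join ∘ FTree.map leaf = id from funext join_map_leaf,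
    Multiset.map_id] at hseq

namespace PreProofNet

variable (π : PreProofNet V)

/-- The forest is first proved without cuts, each cut being an ordinary conclusion `A ⊗ B`; the
duality of its two sides is needed only when these conclusions become cuts again. -/
theorem seq_of_correct (h : π.Correct) :
    Seq π.lab π.link (π.concl : Multiset (FTree V)) (π.cuts : Cuts V) := by
  obtain ⟨hc, hn⟩ := π.correct_iff.1 h
  have hseq : Seq π.lab π.link (π.forest : Multiset (FTree V)) 0 := by
    refine Seq.of_forest ?_ (fun v => ?_) π.link_ne (fun x y => ⟨fun h => ?_, fun h => ?_⟩) hc hn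
    · rw [← coe_flatMap_leaves]; exact π.nodup_forest
    · rw [← coe_flatMap_leaves]; exact π.mem_forest_leaves v
    · exact (Quotient.exact h.symm : y = x ∨ y = π.link x).symm
    · exact (Quotient.sound (show y = x ∨ y = π.link x from h.symm)).symm
  rw [coe_forest] at hseq
  exact (hseq.of_cutTrees _ fun c hc => π.cut_dual c hc).congr rfl (by simp)

theorem correct_iff_seq : π.Correct ↔
    Seq π.lab π.link (π.concl : Multiset (FTree V)) (π.cuts : Cuts V) :=
  ⟨π.seq_of_correct, π.correct_of_seq⟩

theorem sequentializableSC_iff_seq : π.SequentializableSC ↔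
    Seq π.lab π.link (π.concl : Multiset (FTree V)) (π.cuts : Cuts V) := by
  constructor
  · rintro ⟨Γ, P, K, h, hK⟩
    exact h.seq.congr rfl (Multiset.coe_eq_coe.2 hK.symm)
  · intro h
    obtain ⟨Γ, P, K, hP, hK⟩ := h.scDerivable π.link_dual π.concl rfl
    exact ⟨Γ, P, K, hP, Multiset.coe_eq_coe.1 hK⟩

theorem sequentializableCoS_iff_seq : π.SequentializableCoS ↔
    Seq π.lab π.link (π.concl : Multiset (FTree V)) (π.cuts : Cuts V) := by
  constructor
  · rintro ⟨F, P, K, h, hK⟩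
    exact (Seq.of_bigPar (G := 0) (h.seq.congr (add_zero _) rfl)).congr (add_zero _).symm
      (Multiset.coe_eq_coe.2 hK.symm)
  · intro h
    obtain ⟨F, P, K, hP, hK⟩ := h.exists_coSProof π.link_dual
    exact ⟨F, P, K, hP, Multiset.coe_eq_coe.1 hK⟩

end PreProofNet

end Nets

end MLL

theorem mainTheorem1 {V : Type*} (π : MLL.PreProofNet V) :
    (π.Correct ↔ π.Sequentializable) ∧
    (π.Correct ↔ π.SequentializableSC) ∧
    (π.Correct ↔ π.SequentializableCoS) := by
  rw [MLL.PreProofNet.Sequentializable, π.sequentializableSC_iff_seq,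
    π.sequentializableCoS_iff_seq, π.correct_iff_seq, or_self]
  exact ⟨Iff.rfl, Iff.rfl, Iff.rfl⟩
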